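/- **Setting.** For a function $t$ on $\mathbb R$ write $t^*(\omega)=\int_{\mathbb R} e^{i\omega x}t(x)\,dx$. One observes $Y_j=\theta_j+\xi_j$, $j=1,\dots,n$, where all the $\theta_j$ and $\xi_j$ are independent, the $\theta_j$ have an unknown probability density $f$ and the $\xi_j$ have a known probability density $g$. For $s\ge 0$ and $B>0$ let $\Omega_s(B)$ be the set of probability densities $f$ with $\int |f^*(\omega)|^2(\omega^2+1)^s\,d\omega\le B^2$. The target is a (possibly complex valued) linear functional $\Phi$ which, for a measurable function $\varphi^*:\mathbb R\to\mathbb C$, is represented on $\Omega_s(B)$ by an absolutely convergent integral $$\Phi=\Phi(f)=\frac1{2\pi}\int f^*(\omega)\,\varphi^*(-\omega)\,d\omega ,\qquad f\in\Omega_s(B)$$ (for example $\Phi(f)=\int\varphi f$, with $\varphi^*$ the Fourier transform of $\varphi$, or $\Phi(f)=f(x_0)$, with $\varphi^*(\omega)=e^{i\omega x_0}$, whenever this representation holds). For $h\ge0$ the cut-off estimator is $$\widehat\Phi_h=\frac1{2\pi}\int\frac{\widehat{q}^*(\omega)}{g^*(\omega)}\,\varphi^*(-\omega)\,\mathbb I(h|\omega|\le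 1)\,d\omega,\qquad \widehat{q}^*(\omega)=\frac1n\sum_{j=1}^n e^{i\omega Y_j};$$ if $h=0$ and $\varphi^*(-\omega)/g^*(\omega)$ is square integrable but not integrable, then $\widehat\Phi_0=\frac1n\sum_j\psi(Y_j)$, where $\psi(y)=\frac1{2\pi}\int e^{i\omega y}\varphi^*(-\omega)/g^*(\omega)\,d\omega$ is taken in the $L^2$ (Plancherel) sense. Put $R_n(\widehat\Phi_h,\Omega_s(B))=\sup_{f\in\Omega_s(B)}\mathbb E|\widehat\Phi_h-\Phi(f)|^2$. **Assumptions.** The density $g$ is bounded above, and there are constants $C_g>0$, $C_\varphi\ge0$ and $\alpha,\beta,\gamma,a,b,d\ge0$ such that, for all $\omega\in\mathbb R$, $$|g^*(\omega)|\ge C_g(\omega^2+1)^{-\alpha/2}e^{-\gamma|\omega|^\beta},\qquad |\varphi^*(\omega)|\le C_\varphi(\omega^2+1)^{-a/2}e^{-d|\omega|^b},$$ where $\alpha>0$ and $\beta=0$ if $\gamma=0$, and $b=0$ if $d=0$. **Rates.** For real $A_1,A_2$ put $$h^*(n)=\Big[\tfrac1{2\gamma}\Big(\log n-\tfrac{2A_1+2A_2+1-\beta}{\beta}\log\log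 n\Big)\Big]^{-1/\beta},\qquad V_1=\tfrac{2A_1}{\beta}-\tfrac{d(2A_1+2A_2+1-\beta)}{\beta\gamma},$$ and define $\tilde h_n$ and $\Delta_n=\Delta_n(A_1,A_2,b,d,\beta,\gamma)$ as follows. 1. If $b>\beta$: $\Delta_n=n^{-1}$, $\tilde h_n=0$. 2. If $b=\beta>0$, $d>\gamma>0$: $\Delta_n=n^{-1}$, $\tilde h_n=0$. 3. If $b=\beta$, $d=\gamma$, $A_2<-1/2$: $\Delta_n=n^{-1}$, $\tilde h_n=0$. 4. If $b=\beta>0$, $d=\gamma>0$, $A_2=-1/2$: $\Delta_n=n^{-1}\log\log n$, $\tilde h_n=[\log n/(2\gamma)]^{-1/\beta}$. 5. If $b=\beta>0$, $d=\gamma>0$, $A_2>-1/2$: $\Delta_n=n^{-1}(\log n)^{(2A_2+1)/b}$, $\tilde h_n=[\log n/(2\gamma)]^{-1/\beta}$. 6. If $b=\beta=d=\gamma=0$, $A_2=-1/2$: $\Delta_n=n^{-1}\log n$, $\tilde h_n=n^{-1/(2A_1)}$. 7. If $b=\beta=d=\gamma=0$, $A_2>-1/2$: $\Delta_n=n^{-2A_1/(2A_1+2A_2+1)}$,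 $\tilde h_n=n^{-1/(2A_1+2A_2+1)}$. 8. If $b=\beta>0$, $\gamma>d>0$: $\Delta_n=(\log n)^{-V_1}n^{-d/\gamma}$, $\tilde h_n=h^*(n)$. 9. If $\beta>b>0$, $d>0$, $\gamma>0$: $\Delta_n=(\log n)^{-2A_1/\beta}\exp(-2d[h^*(n)]^{-b})$, $\tilde h_n=h^*(n)$. 10. If $b=d=0$, $\beta>0$, $\gamma>0$: $\Delta_n=(\log n)^{-2A_1/\beta}$, $\tilde h_n=h^*(n)$. **Theorem.** Take $A_1=s+a+(b-1)/2$ and $A_2=\alpha-a$. In each of the ten cases there is a constant $C>0$, independent of $n$, such that for all sufficiently large $n$ $$R_n(\widehat\Phi_{\tilde h_n},\Omega_s(B))\le C\,\Delta_n\big(s+a+(b-1)/2,\ \alpha-a,\ b,d,\beta,\gamma\big).$$ -/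

import Mathlib

open MeasureTheory Filter Topology
open scoped ENNReal FourierTransform

noncomputable section

namespace Deconv

/-- The Fourier transform `t*(ω) = ∫ exp(i ω x) t(x) dx`. -/
def ft (t : ℝ → ℝ) (ω : ℝ) : ℂ :=
  ∫ x : ℝ, Complex.exp (Complex.I * (ω * x : ℝ)) * (t x : ℂ)

/-- `f` is a probability density function on the line. -/
structure IsPdf (f : ℝ → ℝ) : Prop where
  measurable : Measurable f
  nonneg : ∀ x, 0 ≤ f x
  lintegral_eq_one : ∫⁻ x : ℝ, ENNReal.ofReal (f x) = 1

/-- The probability distribution with density `f`. -/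
def law (f : ℝ → ℝ) : Measure ℝ :=
  volume.withDensity fun x => ENNReal.ofReal (f x)

/-- The class `Ω_s(B)`: the probability densities `f` with
`∫ |f*(ω)|² (ω² + 1)^s dω ≤ B²`. -/
def sobolevBall (s B : ℝ) : Set (ℝ → ℝ) :=
  {f | IsPdf f ∧
    ∫⁻ ω : ℝ, ENNReal.ofReal (‖ft f ω‖ ^ 2 * (ω ^ 2 + 1) ^ s) ≤ ENNReal.ofReal (B ^ 2)}

/-- The distribution of `(Y_1, …, Y_n)` where `Y_j = θ_j + ξ_j` and all the `θ_j ∼ f`, `ξ_j ∼ g`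
are independent. -/
def sampleLaw (f g : ℝ → ℝ) (n : ℕ) : Measure (Fin n → ℝ) :=
  Measure.pi fun _ : Fin n => ((law f).prod (law g)).map fun p : ℝ × ℝ => p.1 + p.2

/-- The functional `Φ` is represented on the class `F` by an absolutely convergent integral
`Φ(f) = (1 / 2π) ∫ f*(ω) φ*(-ω) dω`. The function `φs` stands for `φ*`. -/
def IsRepresentedOn (F : Set (ℝ → ℝ)) (Φ : (ℝ → ℝ) → ℂ) (φs : ℝ → ℂ) : Prop :=
  ∀ f ∈ F, Integrable (fun ω : ℝ => ft f ω * φs (-ω)) ∧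
    Φ f = (2 * Real.pi : ℂ)⁻¹ * ∫ ω : ℝ, ft f ω * φs (-ω)

/-- The empirical characteristic function `n⁻¹ ∑ exp(i ω Y_j)`. -/
def empFt {n : ℕ} (Y : Fin n → ℝ) (ω : ℝ) : ℂ :=
  (n : ℂ)⁻¹ * ∑ j, Complex.exp (Complex.I * (ω * Y j : ℝ))

/-- The function `ω ↦ (φ*(-ω) / g*(ω)) 𝟙(|ω| ≤ 1/h)`. The condition `|ω| ≤ 1/h` is written
`h |ω| ≤ 1`, so that `h = 0` means that there is no cut-off. -/
def cutoffRatio (g : ℝ → ℝ) (φs : ℝ → ℂ) (h ω : ℝ) : ℂ :=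
  open Classical in if h * |ω| ≤ 1 then φs (-ω) / ft g ω else 0

/-- The function `y ↦ (1 / 2π) ∫ exp(i ω y) r(ω) dω` of a square integrable `r`, in the sense of
Plancherel. As `(1 / 2π) ∫ exp(i ω y) r(ω) dω = ∫ exp(2 π i x y) r(2 π x) dx`, this is Mathlib's
inverse Fourier transform of `x ↦ r(2 π x)`. -/
def plancherelKernel (r : ℝ → ℂ) : ℝ → ℂ :=
  open Classical in
  if hr : MemLp (fun x : ℝ => r (2 * Real.pi * x)) 2 (volume : Measure ℝ) then
    ((𝓕⁻ (hr.toLp (fun x : ℝ => r (2 * Real.pi * x))) : Lp ℂ 2 (volume : Measure ℝ)) : ℝ → ℂ)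
  else 0

/-- The cut-off estimator
`(1 / 2π) ∫ (q̂*(ω) / g*(ω)) φ*(-ω) 𝟙(|ω| ≤ 1/h) dω`, with `q̂*` the empirical characteristic
function. The integral is an ordinary one if `(φ*(-·) / g*) 𝟙(|·| ≤ 1/h)` is integrable, as it
always is for `h > 0` when `φ*` and `1/g*` are locally bounded. If that function is only square
integrable (this can occur for `h = 0`), the integral
`n⁻¹ ∑ (1 / 2π) ∫ exp(i ω Y_j) (φ*(-ω) / g*(ω)) dω` is understood in the sense of Plancherel;
it is then defined almost surely, because `Y_j` has a density. -/
def estimator (g : ℝ → ℝ) (φs : ℝ → ℂ) (h : ℝ) {n : ℕ} (Y : Fin n → ℝ) : ℂ :=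
  open Classical in
  if Integrable (cutoffRatio g φs h) then
    (2 * Real.pi : ℂ)⁻¹ * ∫ ω : ℝ, empFt Y ω * cutoffRatio g φs h ω
  else (n : ℂ)⁻¹ * ∑ j, plancherelKernel (cutoffRatio g φs h) (Y j)

/-- The worst-case mean squared error `sup_{f ∈ F} E |Φ̂_h - Φ(f)|²`. -/
def worstRisk (F : Set (ℝ → ℝ)) (g : ℝ → ℝ) (Φ : (ℝ → ℝ) → ℂ) (φs : ℝ → ℂ) (n : ℕ) (h : ℝ) :
    ℝ≥0∞ :=
  ⨆ f ∈ F, ∫⁻ Y, ‖estimator g φs h Y - Φ f‖ₑ ^ 2 ∂(sampleLaw f g n)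

/-- The bandwidth `h*(n)`. -/
def hStar (A₁ A₂ β γ : ℝ) (n : ℕ) : ℝ :=
  (1 / (2 * γ) * (Real.log n - (2 * A₁ + 2 * A₂ + 1 - β) / β * Real.log (Real.log n))) ^ (-1 / β)

/-- The exponent `V₁`. -/
def V₁ (A₁ A₂ d β γ : ℝ) : ℝ :=
  2 * A₁ / β - d * (2 * A₁ + 2 * A₂ + 1 - β) / (β * γ)

/-- The table of rates: `RateTable A₁ A₂ b d β γ h Δ` says that the parameters
`A₁, A₂, b, d, β, γ` belong to one of the ten regimes, and that `n ↦ h n` is the bandwidth and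
`n ↦ Δ n` the rate of that regime. -/
inductive RateTable (A₁ A₂ b d β γ : ℝ) : (ℕ → ℝ) → (ℕ → ℝ) → Prop
  | case1 (hb : b > β) :
      RateTable A₁ A₂ b d β γ (fun _ => 0) (fun n => (n : ℝ)⁻¹)
  | case2 (hb : b = β) (hβ : β > 0) (hd : d > γ) (hγ : γ > 0) :
      RateTable A₁ A₂ b d β γ (fun _ => 0) (fun n => (n : ℝ)⁻¹)
  | case3 (hb : b = β) (hd : d = γ) (hA : A₂ < -1 / 2) :
      RateTable A₁ A₂ b d β γ (fun _ => 0) (fun n => (n : ℝ)⁻¹)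
  | case4 (hb : b = β) (hβ : β > 0) (hd : d = γ) (hγ : γ > 0) (hA : A₂ = -1 / 2) :
      RateTable A₁ A₂ b d β γ (fun n => (Real.log n / (2 * γ)) ^ (-1 / β))
        (fun n => (n : ℝ)⁻¹ * Real.log (Real.log n))
  | case5 (hb : b = β) (hβ : β > 0) (hd : d = γ) (hγ : γ > 0) (hA : A₂ > -1 / 2) :
      RateTable A₁ A₂ b d β γ (fun n => (Real.log n / (2 * γ)) ^ (-1 / β))
        (fun n => (n : ℝ)⁻¹ * Real.log n ^ ((2 * A₂ + 1) / b))
  | case6 (hb : b = 0) (hβ : β = 0) (hd : d = 0) (hγ : γ = 0) (hA : A₂ = -1 / 2) :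
      RateTable A₁ A₂ b d β γ (fun n => (n : ℝ) ^ (-1 / (2 * A₁)))
        (fun n => (n : ℝ)⁻¹ * Real.log n)
  | case7 (hb : b = 0) (hβ : β = 0) (hd : d = 0) (hγ : γ = 0) (hA : A₂ > -1 / 2) :
      RateTable A₁ A₂ b d β γ (fun n => (n : ℝ) ^ (-1 / (2 * A₁ + 2 * A₂ + 1)))
        (fun n => (n : ℝ) ^ (-(2 * A₁) / (2 * A₁ + 2 * A₂ + 1)))
  | case8 (hb : b = β) (hβ : β > 0) (hd : γ > d) (hd₀ : d > 0) :
      RateTable A₁ A₂ b d β γ (hStar A₁ A₂ β γ)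
        (fun n => Real.log n ^ (-V₁ A₁ A₂ d β γ) * (n : ℝ) ^ (-d / γ))
  | case9 (hβ : β > b) (hb : b > 0) (hd : d > 0) (hγ : γ > 0) :
      RateTable A₁ A₂ b d β γ (hStar A₁ A₂ β γ)
        (fun n => Real.log n ^ (-(2 * A₁) / β) *
          Real.exp (-2 * d * hStar A₁ A₂ β γ n ^ (-b)))
  | case10 (hb : b = 0) (hd : d = 0) (hβ : β > 0) (hγ : γ > 0) :
      RateTable A₁ A₂ b d β γ (hStar A₁ A₂ β γ)
        (fun n => Real.log n ^ (-(2 * A₁) / β))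

end Deconv

end

open MeasureTheory Filter Topology
open scoped ENNReal FourierTransform

namespace Deconv

/-! The proof is a bias-variance decomposition on the Fourier side. With `r = cutoffRatio g φs h`
square integrable, the estimator is almost surely the sample mean of `plancherelKernel r` at the
observations. These have density `q = f * g`, bounded by `M = sup g` whatever `f` is, so Plancherel
bounds the variance by `M (2π n)⁻¹ ∫ |r|²`, uniformly in `f`. Since `q* = f* g*`, Parseval shows
that the mean is the integral representing `Φ(f)`, restricted to `h|ω| ≤ 1`. The bias is therefore
the remaining tail, and Cauchy-Schwarz with the Sobolev weight bounds it (`worstRisk_le`,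
`setIntegral_norm_ft_mul_le`).

What remains is to estimate integrals of `(t² + 1)^p exp(P t^x + Q t^y)` up to, or beyond, a cut-off
`T = 1/h`. Such an integral is compared with `t^(2p+1-x) exp(P t^x + Q t^y)`, whose logarithmic
derivative is asymptotic to `κ t^(x-1)`. The sign of `κ` decides between growth and decay, and `κ =
0` gives the logarithmic regimes. The variance is then of order `n⁻¹ T^(2A₂+1-β) exp(2γT^β - 2dT^b)`
when `γ` dominates, the squared bias of order `T^(-2A₁) exp(-2dT^b)`, and `h*` balances the two.

One point is not computational. If `b = d = 0` and `A₁ ≤ 0`, the Cauchy-Schwarz bound on the bias is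
useless, but the claimed rate is then at least one. It suffices that the bias is bounded over the
Sobolev ball, and this follows by Baire's theorem from absolute convergence for each single `f`
(`exists_bound_integral_norm_ft_mul`). -/

/-! ### The Fourier transform on L¹ ∩ L² and Parseval's identity -/

theorem integral_fourier_mul_eq_flip {u v : ℝ → ℂ} (hu : Integrable u) (hv : Integrable v) :
    ∫ x, 𝓕 u x * v x = ∫ x, u x * 𝓕 v x := by
  have := VectorFourier.integral_fourierIntegral_smul_eq_flip (μ := (volume : Measure ℝ))
    (ν := (volume : Measure ℝ)) (L := innerₗ ℝ) Real.continuous_fourierChar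
    continuous_inner hu hv
  rw [flip_innerₗ] at this
  exact this

/-- Both sides define the same tempered distribution: against a smooth compactly supported `w`,
which is a Schwartz function, either transform can be moved onto `w`. -/
theorem Lp_fourier_toLp_ae {u : ℝ → ℂ} (h1 : Integrable u) (h2 : MemLp u 2) :
    ((𝓕 (h2.toLp u) : Lp ℂ 2 (volume : Measure ℝ)) : ℝ → ℂ) =ᵐ[volume] 𝓕 u := by
  have hcont : Continuous (𝓕 u) :=
    VectorFourier.fourierIntegral_continuous Real.continuous_fourierChar
      continuous_inner h1
  apply ae_eq_of_integral_contDiff_smul_eq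
    ((Lp.memLp (𝓕 (h2.toLp u))).locallyIntegrable (by norm_num)) hcont.locallyIntegrable
  intro w hw hwc
  have hg₁ : HasCompactSupport (Complex.ofRealCLM ∘ w) := hwc.comp_left rfl
  have hg₂ : ContDiff ℝ (⊤ : ℕ∞) (Complex.ofRealCLM ∘ w) := by fun_prop
  set W : SchwartzMap ℝ ℂ := hg₁.toSchwartzMap hg₂ with hW
  have hWx : ∀ x, W x = (w x : ℂ) := fun x => rfl
  have key := congrArg (fun T => T W) (Lp.fourier_toTemperedDistribution_eq (h2.toLp u))
  simp only [TemperedDistribution.fourier_apply, Lp.toTemperedDistribution_apply, hWx] at key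
  have h3 : ∫ x, (𝓕 W) x • (h2.toLp u) x = ∫ x, 𝓕 (W : ℝ → ℂ) x * u x := by
    apply integral_congr_ae
    filter_upwards [h2.coeFn_toLp] with x hx
    rw [hx]; rfl
  rw [h3, integral_fourier_mul_eq_flip W.integrable h1] at key
  simp only [hWx, smul_eq_mul] at key
  simp only [Complex.real_smul]
  exact key.symm

theorem Lp_fourierInv_toLp_ae {u : ℝ → ℂ} (h1 : Integrable u) (h2 : MemLp u 2) :
    ((𝓕⁻ (h2.toLp u) : Lp ℂ 2 (volume : Measure ℝ)) : ℝ → ℂ) =ᵐ[volume] 𝓕⁻ u := by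
  have hcont : Continuous (𝓕⁻ u) := by
    rw [Real.fourierInv_eq_fourier_comp_neg]
    exact VectorFourier.fourierIntegral_continuous Real.continuous_fourierChar
      continuous_inner h1.comp_neg
  apply ae_eq_of_integral_contDiff_smul_eq
    ((Lp.memLp (𝓕⁻ (h2.toLp u))).locallyIntegrable (by norm_num)) hcont.locallyIntegrable
  intro w hw hwc
  have hg₁ : HasCompactSupport (Complex.ofRealCLM ∘ w) := hwc.comp_left rfl
  have hg₂ : ContDiff ℝ (⊤ : ℕ∞) (Complex.ofRealCLM ∘ w) := by fun_prop
  set W : SchwartzMap ℝ ℂ := hg₁.toSchwartzMap hg₂ with hW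
  have hWx : ∀ x, W x = (w x : ℂ) := fun x => rfl
  have key := congrArg (fun T => T W) (Lp.fourierInv_toTemperedDistribution_eq (h2.toLp u))
  simp only [TemperedDistribution.fourierInv_apply, Lp.toTemperedDistribution_apply, hWx] at key
  -- A reflection turns `𝓕⁻` into `𝓕`, so that the flip formula applies.
  have h3 : ∫ x, (𝓕⁻ W) x • (h2.toLp u) x = ∫ x, 𝓕 (W : ℝ → ℂ) x * u (-x) := by
    rw [← integral_neg_eq_self (fun x => 𝓕 (W : ℝ → ℂ) x * u (-x))]
    apply integral_congr_ae
    filter_upwards [h2.coeFn_toLp] with x hx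
    rw [hx, SchwartzMap.fourierInv_coe, Real.fourierInv_eq_fourier_neg, neg_neg]; rfl
  rw [h3, integral_fourier_mul_eq_flip W.integrable h1.comp_neg] at key
  simp only [hWx, smul_eq_mul] at key
  simp only [Complex.real_smul, Real.fourierInv_eq_fourier_comp_neg]
  exact key.symm

/-- Parseval's identity, with one of the two functions integrable. -/
theorem integral_conj_mul_fourierInv {q R : ℝ → ℂ} (h1 : Integrable q) (h2 : MemLp q 2)
    (hR : MemLp R 2) :
    ∫ x, starRingEnd ℂ (q x) * (𝓕⁻ (hR.toLp R) : Lp ℂ 2 (volume : Measure ℝ)) x =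
      ∫ x, starRingEnd ℂ (𝓕 q x) * R x := by
  have key := Lp.inner_fourier_eq (h2.toLp q) (𝓕⁻ (hR.toLp R))
  rw [FourierTransform.fourier_fourierInv_eq] at key
  rw [L2.inner_def, L2.inner_def] at key
  rw [integral_congr_ae (g := fun x => starRingEnd ℂ (𝓕 q x) * R x)] at key
  · rw [key]
    apply integral_congr_ae
    filter_upwards [h2.coeFn_toLp] with x hx
    rw [hx]; simp [mul_comm]
  · filter_upwards [hR.coeFn_toLp, Lp_fourier_toLp_ae h1 h2] with x hx hy
    rw [hx, hy]; simp [mul_comm]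

/-! ### Laws, densities and characteristic functions -/

theorem IsPdf.isProbabilityMeasure {f : ℝ → ℝ} (hf : IsPdf f) : IsProbabilityMeasure (law f) :=
  ⟨by rw [law, withDensity_apply _ MeasurableSet.univ]; simpa using hf.lintegral_eq_one⟩

theorem IsPdf.integrable {f : ℝ → ℝ} (hf : IsPdf f) : Integrable f := by
  refine ⟨hf.measurable.aestronglyMeasurable, ?_⟩
  rw [hasFiniteIntegral_iff_ofReal (Eventually.of_forall hf.nonneg), hf.lintegral_eq_one]
  exact ENNReal.one_lt_top

theorem integral_law {f : ℝ → ℝ} (hf : IsPdf f) (v : ℝ → ℂ) :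
    ∫ x, v x ∂(law f) = ∫ x, v x * (f x : ℂ) := by
  have : law f = volume.withDensity fun x => ((f x).toNNReal : ℝ≥0∞) := rfl
  rw [this, integral_withDensity_eq_integral_smul hf.measurable.real_toNNReal]
  congr 1 with x
  rw [NNReal.smul_def, Real.coe_toNNReal _ (hf.nonneg x), Complex.real_smul, mul_comm]

theorem charFun_law {f : ℝ → ℝ} (hf : IsPdf f) (ω : ℝ) : charFun (law f) ω = ft f ω := by
  rw [charFun_apply_real, integral_law hf, ft]
  congr 1 with x
  congr 2
  push_cast; ring

theorem IsPdf.continuous_ft {f : ℝ → ℝ} (hf : IsPdf f) : Continuous (ft f) := by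
  have := hf.isProbabilityMeasure
  have h : ft f = charFun (law f) := funext fun ω => (charFun_law hf ω).symm
  rw [h]
  exact continuous_charFun

/-- The law of `θ + ξ` with `θ ∼ f` and `ξ ∼ g` independent. -/
noncomputable def sumLaw (f g : ℝ → ℝ) : Measure ℝ := (law f) ∗ (law g)

theorem sampleLaw_eq (f g : ℝ → ℝ) (n : ℕ) :
    sampleLaw f g n = Measure.pi fun _ : Fin n => sumLaw f g := rfl

theorem isProbabilityMeasure_sumLaw {f g : ℝ → ℝ} (hf : IsPdf f) (hg : IsPdf g) :
    IsProbabilityMeasure (sumLaw f g) := by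
  have := hf.isProbabilityMeasure
  have := hg.isProbabilityMeasure
  unfold sumLaw
  infer_instance

theorem charFun_sumLaw {f g : ℝ → ℝ} (hf : IsPdf f) (hg : IsPdf g) (ω : ℝ) :
    charFun (sumLaw f g) ω = ft f ω * ft g ω := by
  have := hf.isProbabilityMeasure
  have := hg.isProbabilityMeasure
  rw [sumLaw, charFun_conv, charFun_law hf, charFun_law hg]

/-- Averaging `g` against a probability density cannot exceed `sup g`. The bound does not involve
`f`, which makes the variance estimate uniform over the class. -/
theorem exists_isPdf_law_eq_sumLaw {f g : ℝ → ℝ} (hf : IsPdf f) (hg : IsPdf g) {M : ℝ}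
    (hM : ∀ x, g x ≤ M) : ∃ q, IsPdf q ∧ (∀ x, q x ≤ M) ∧ sumLaw f g = law q := by
  have hM0 : 0 ≤ M := (hg.nonneg 0).trans (hM 0)
  set F : ℝ → ℝ≥0∞ := fun x => ENNReal.ofReal (f x)
  set G : ℝ → ℝ≥0∞ := fun x => ENNReal.ofReal (g x)
  have hF : Measurable F := hf.measurable.ennreal_ofReal
  have hG : Measurable G := hg.measurable.ennreal_ofReal
  set Q : ℝ → ℝ≥0∞ := lconvolution F G volume
  have hQ : Measurable Q := measurable_lconvolution volume hF hG
  have hle : ∀ x, Q x ≤ ENNReal.ofReal M := fun x => by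
    calc Q x ≤ ∫⁻ y, F y * ENNReal.ofReal M :=
          lintegral_mono fun y => by gcongr; exact ENNReal.ofReal_le_ofReal (hM _)
      _ = ENNReal.ofReal M := by
          rw [lintegral_mul_const _ hF, hf.lintegral_eq_one, one_mul]
  have hfin : ∀ x, Q x ≠ ∞ := fun x => ((hle x).trans_lt ENNReal.ofReal_lt_top).ne
  have hlaw : sumLaw f g = law fun x => (Q x).toReal := by
    have h1 : sumLaw f g = volume.withDensity Q := conv_withDensity_eq_lconvolution hF hG
    rw [h1, law]
    congr 1 with x
    rw [ENNReal.ofReal_toReal (hfin x)]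
  refine ⟨fun x => (Q x).toReal, ⟨hQ.ennreal_toReal, fun x => ENNReal.toReal_nonneg, ?_⟩,
    fun x => ENNReal.toReal_le_of_le_ofReal hM0 (hle x), hlaw⟩
  have h2 := isProbabilityMeasure_sumLaw hf hg
  rw [hlaw] at h2
  simpa [law, withDensity_apply _ MeasurableSet.univ] using h2.measure_univ

theorem lintegral_law_le {q : ℝ → ℝ} (hq : IsPdf q) {M : ℝ} (hM : ∀ x, q x ≤ M) {v : ℝ → ℝ≥0∞}
    (hv : AEMeasurable v) : ∫⁻ x, v x ∂(law q) ≤ ENNReal.ofReal M * ∫⁻ x, v x := by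
  rw [law, lintegral_withDensity_eq_lintegral_mul₀ hq.measurable.ennreal_ofReal.aemeasurable hv,
    ← lintegral_const_mul' _ _ ENNReal.ofReal_ne_top]
  refine lintegral_mono fun x => ?_
  simp only [Pi.mul_apply]
  gcongr
  exact hM x

theorem law_absolutelyContinuous (q : ℝ → ℝ) : law q ≪ volume := withDensity_absolutelyContinuous _ _

theorem memLp_two_law {q : ℝ → ℝ} (hq : IsPdf q) {M : ℝ} (hM : ∀ x, q x ≤ M) {v : ℝ → ℂ}
    (hv : MemLp v 2) : MemLp v 2 (law q) := by
  refine ⟨hv.1.mono_ac (law_absolutelyContinuous q), ?_⟩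
  rw [eLpNorm_lt_top_iff_lintegral_rpow_enorm_lt_top (by norm_num) (by norm_num)]
  refine (lintegral_law_le hq hM (hv.1.enorm.pow_const _)).trans_lt ?_
  exact ENNReal.mul_lt_top ENNReal.ofReal_lt_top
    (lintegral_rpow_enorm_lt_top_of_eLpNorm_lt_top (by norm_num) (by norm_num) hv.2)

/-! ### Mean squared error of a sample mean -/

open ProbabilityTheory in
-- Mean squared error is variance plus squared bias. By independence the variance of the mean is
-- `n⁻¹ Var X`, and `Var X ≤ E X²`.
theorem integral_sample_mean_sub_sq {ν : Measure ℝ} [IsProbabilityMeasure ν] {X : ℝ → ℝ}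
    (hX : MemLp X 2 ν) {n : ℕ} (hn : 0 < n) (c : ℝ) :
    MemLp (fun Y : Fin n → ℝ => (n : ℝ)⁻¹ * ∑ j, X (Y j) - c) 2 (Measure.pi fun _ => ν) ∧
    ∫ Y, ((n : ℝ)⁻¹ * ∑ j, X (Y j) - c) ^ 2 ∂(Measure.pi fun _ : Fin n => ν) ≤
      (n : ℝ)⁻¹ * ∫ y, X y ^ 2 ∂ν + (∫ y, X y ∂ν - c) ^ 2 := by
  have hn' : (n : ℝ) ≠ 0 := by positivity
  set P := Measure.pi fun _ : Fin n => ν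
  have hXj : ∀ j : Fin n, MemLp (fun Y : Fin n → ℝ => X (Y j)) 2 P := fun j =>
    hX.comp_measurePreserving (measurePreserving_eval _ j)
  have hS : MemLp (fun Y : Fin n → ℝ => ∑ j, X (Y j)) 2 P := memLp_finsetSum _ fun j _ => hXj j
  have hT : MemLp (fun Y : Fin n → ℝ => (n : ℝ)⁻¹ * ∑ j, X (Y j) - c) 2 P :=
    (hS.const_mul _).sub (memLp_const c)
  refine ⟨hT, ?_⟩
  have h1 := variance_eq_sub hT
  have hmean : ∫ Y, ((n : ℝ)⁻¹ * ∑ j, X (Y j) - c) ∂P = ∫ y, X y ∂ν - c := by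
    rw [integral_sub ((hS.integrable (by norm_num)).const_mul _) (integrable_const _),
      integral_const_mul, integral_finsetSum _ fun j _ => (hXj j).integrable (by norm_num)]
    have : ∀ j : Fin n, ∫ Y : Fin n → ℝ, X (Y j) ∂P = ∫ y, X y ∂ν := fun j => by
      have hmp := measurePreserving_eval (fun _ : Fin n => ν) j
      have h2 := integral_map (f := X) hmp.measurable.aemeasurable (by rw [hmp.map_eq]; exact hX.1)
      rw [hmp.map_eq] at h2
      exact h2.symm
    simp [this]
    field_simp
  have hvar : Var[fun Y : Fin n → ℝ => (n : ℝ)⁻¹ * ∑ j, X (Y j) - c; P] =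
      (n : ℝ)⁻¹ * Var[X; ν] := by
    rw [variance_sub_const (hS.const_mul _).1, variance_const_mul]
    have := variance_sum_pi (ι := Fin n) (μ := fun _ => ν) (X := fun _ => X) fun _ => hX
    have h2 : (∑ i : Fin n, fun Y : Fin n → ℝ => X (Y i)) = fun Y => ∑ i, X (Y i) := by
      ext Y; simp
    rw [h2] at this
    rw [this]
    simp
    field_simp
  rw [hmean, hvar] at h1
  have h3 := variance_le_expectation_sq (hX.1)
  have h4 : (n : ℝ)⁻¹ * Var[X; ν] ≤ (n : ℝ)⁻¹ * ∫ y, X y ^ 2 ∂ν := by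
    gcongr
    simpa using h3
  simp only [Pi.pow_apply] at h1
  linarith

/-- The mean squared error of a sample mean. -/
theorem lintegral_sample_mean_sub_sq {ν : Measure ℝ} [IsProbabilityMeasure ν] {k : ℝ → ℂ}
    (hk : MemLp k 2 ν) {n : ℕ} (hn : 0 < n) (z : ℂ) :
    ∫⁻ Y, ‖(n : ℂ)⁻¹ * ∑ j, k (Y j) - z‖ₑ ^ 2 ∂(Measure.pi fun _ : Fin n => ν) ≤
      ENNReal.ofReal ((n : ℝ)⁻¹ * ∫ y, ‖k y‖ ^ 2 ∂ν + ‖∫ y, k y ∂ν - z‖ ^ 2) := by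
  obtain ⟨hr, hr'⟩ := integral_sample_mean_sub_sq hk.re hn z.re
  obtain ⟨hi, hi'⟩ := integral_sample_mean_sub_sq hk.im hn z.im
  have hk1 : Integrable k ν := hk.integrable (by norm_num)
  have hsq : ∀ w : ℂ, ‖w‖ ^ 2 = w.re ^ 2 + w.im ^ 2 := fun w => by
    rw [Complex.sq_norm, Complex.normSq_apply]; ring
  have hre : ∀ Y : Fin n → ℝ, ((n : ℂ)⁻¹ * ∑ j, k (Y j) - z).re =
      (n : ℝ)⁻¹ * ∑ j, RCLike.re (k (Y j)) - z.re := fun Y => by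
    have : (n : ℂ)⁻¹ = (((n : ℝ)⁻¹ : ℝ) : ℂ) := by push_cast; rfl
    rw [this]
    simp
  have him : ∀ Y : Fin n → ℝ, ((n : ℂ)⁻¹ * ∑ j, k (Y j) - z).im =
      (n : ℝ)⁻¹ * ∑ j, RCLike.im (k (Y j)) - z.im := fun Y => by
    have : (n : ℂ)⁻¹ = (((n : ℝ)⁻¹ : ℝ) : ℂ) := by push_cast; rfl
    rw [this]
    simp
  have hpt : ∀ Y : Fin n → ℝ, ‖(n : ℂ)⁻¹ * ∑ j, k (Y j) - z‖ₑ ^ 2 =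
      ENNReal.ofReal (((n : ℝ)⁻¹ * ∑ j, RCLike.re (k (Y j)) - z.re) ^ 2 +
        ((n : ℝ)⁻¹ * ∑ j, RCLike.im (k (Y j)) - z.im) ^ 2) := fun Y => by
    rw [← hre, ← him, ← hsq, ENNReal.ofReal_pow (norm_nonneg _), ofReal_norm]
  simp only [hpt]
  have hadd := hr.integrable_sq.add hi.integrable_sq
  simp only [Pi.add_def] at hadd
  rw [← ofReal_integral_eq_lintegral_ofReal hadd
    (Eventually.of_forall fun Y => by positivity)]
  apply ENNReal.ofReal_le_ofReal
  rw [integral_add hr.integrable_sq hi.integrable_sq]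
  have e1 : ∫ y, ‖k y‖ ^ 2 ∂ν = ∫ y, RCLike.re (k y) ^ 2 ∂ν + ∫ y, RCLike.im (k y) ^ 2 ∂ν := by
    rw [← integral_add hk.re.integrable_sq hk.im.integrable_sq]
    exact integral_congr_ae (Eventually.of_forall fun y => hsq (k y))
  have e2 : ‖∫ y, k y ∂ν - z‖ ^ 2 =
      (∫ y, RCLike.re (k y) ∂ν - z.re) ^ 2 + (∫ y, RCLike.im (k y) ∂ν - z.im) ^ 2 := by
    rw [hsq, integral_re hk1, integral_im hk1]; simp
  rw [e1, e2]
  linarith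

/-! ### The Plancherel kernel and the change of Fourier convention -/

theorem integral_comp_two_pi_mul (v : ℝ → ℂ) :
    ∫ x : ℝ, v (2 * Real.pi * x) = (2 * Real.pi : ℂ)⁻¹ * ∫ ω : ℝ, v ω := by
  rw [Measure.integral_comp_mul_left, abs_of_pos (by positivity), Complex.real_smul]
  push_cast; rfl

theorem fourierInv_comp_two_pi_mul (r : ℝ → ℂ) (y : ℝ) :
    𝓕⁻ (fun x : ℝ => r (2 * Real.pi * x)) y =
      (2 * Real.pi : ℂ)⁻¹ * ∫ ω : ℝ, Complex.exp (Complex.I * (ω * y : ℝ)) * r ω := by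
  rw [← integral_comp_two_pi_mul (fun ω => Complex.exp (Complex.I * (ω * y : ℝ)) * r ω),
    Real.fourierInv_eq']
  congr 1 with x
  rw [smul_eq_mul]
  congr 2
  simp only [RCLike.inner_apply, conj_trivial]
  push_cast; ring

/-- As `q` is real, conjugation only reverses the sign in the exponent. This matches the conjugate
in Parseval's identity with the convention of `ft`. -/
theorem conj_fourier_ofReal (q : ℝ → ℝ) (x : ℝ) :
    starRingEnd ℂ (𝓕 (fun v : ℝ => (q v : ℂ)) x) = ft q (2 * Real.pi * x) := by
  rw [Real.fourier_real_eq_integral_exp_smul, ← integral_conj, ft]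
  congr 1 with v
  rw [smul_eq_mul, map_mul, ← Complex.exp_conj, Complex.conj_ofReal]
  congr 2
  rw [map_mul, Complex.conj_ofReal, Complex.conj_I]
  push_cast; ring

theorem memLp_comp_two_pi_mul {r : ℝ → ℂ} (hr : MemLp r 2) :
    MemLp (fun x : ℝ => r (2 * Real.pi * x)) 2 := by
  have hq : Measure.QuasiMeasurePreserving (fun x : ℝ => 2 * Real.pi * x) volume volume := by
    refine ⟨by fun_prop, ?_⟩
    rw [Real.map_volume_mul_left (by positivity)]
    exact Measure.smul_absolutelyContinuous
  have h1 : AEStronglyMeasurable (fun x : ℝ => r (2 * Real.pi * x)) volume :=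
    hr.1.comp_quasiMeasurePreserving hq
  rw [memLp_two_iff_integrable_sq_norm h1]
  exact ((memLp_two_iff_integrable_sq_norm hr.1).1 hr).comp_mul_left' (by positivity)

theorem plancherelKernel_eq {r : ℝ → ℂ} (hR : MemLp (fun x : ℝ => r (2 * Real.pi * x)) 2) :
    plancherelKernel r =
      ((𝓕⁻ (hR.toLp (fun x : ℝ => r (2 * Real.pi * x))) : Lp ℂ 2 (volume : Measure ℝ))) := by
  rw [plancherelKernel, dif_pos hR]

theorem memLp_plancherelKernel {r : ℝ → ℂ} (hr : MemLp r 2) : MemLp (plancherelKernel r) 2 := by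
  rw [plancherelKernel_eq (memLp_comp_two_pi_mul hr)]
  exact Lp.memLp _

theorem integral_norm_sq_Lp (u : Lp ℂ 2 (volume : Measure ℝ)) : ∫ x, ‖u x‖ ^ 2 = ‖u‖ ^ 2 := by
  have h := congrArg Complex.re (L2.inner_def u u (𝕜 := ℂ))
  have h2 : ∀ x, inner ℂ (u x) (u x) = ((‖u x‖ ^ 2 : ℝ) : ℂ) := fun x => by
    rw [inner_self_eq_norm_sq_to_K]; push_cast; rfl
  simp only [h2] at h
  rw [integral_complex_ofReal, inner_self_eq_norm_sq_to_K] at h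
  norm_cast at h
  exact h.symm

theorem integral_norm_sq_plancherelKernel {r : ℝ → ℂ} (hr : MemLp r 2) :
    ∫ x, ‖plancherelKernel r x‖ ^ 2 = (2 * Real.pi)⁻¹ * ∫ ω, ‖r ω‖ ^ 2 := by
  have hR := memLp_comp_two_pi_mul hr
  rw [plancherelKernel_eq hR, integral_norm_sq_Lp,
    ← Lp.norm_fourier_eq, FourierTransform.fourier_fourierInv_eq, ← integral_norm_sq_Lp]
  have h1 : ∫ x, ‖(hR.toLp (fun x : ℝ => r (2 * Real.pi * x))) x‖ ^ 2 =
      ∫ x, ‖r (2 * Real.pi * x)‖ ^ 2 := by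
    apply integral_congr_ae
    filter_upwards [hR.coeFn_toLp] with x hx
    rw [hx]
  rw [h1, Measure.integral_comp_mul_left (fun ω => ‖r ω‖ ^ 2), abs_of_pos (by positivity),
    smul_eq_mul]

theorem integral_norm_sq_law_le {q : ℝ → ℝ} (hq : IsPdf q) {M : ℝ} (hM : ∀ x, q x ≤ M)
    {k : ℝ → ℂ} (hk : MemLp k 2) :
    ∫ y, ‖k y‖ ^ 2 ∂(law q) ≤ M * ∫ y, ‖k y‖ ^ 2 := by
  have hM0 : 0 ≤ M := (hq.nonneg 0).trans (hM 0)
  have h1 := hk.integrable_norm_pow (by norm_num)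
  have h2 := (memLp_two_law hq hM hk).integrable_norm_pow (by norm_num)
  rw [← ENNReal.ofReal_le_ofReal_iff (by positivity), ENNReal.ofReal_mul hM0,
    ofReal_integral_eq_lintegral_ofReal (by simpa using h2) (Eventually.of_forall fun _ => by positivity),
    ofReal_integral_eq_lintegral_ofReal (by simpa using h1) (Eventually.of_forall fun _ => by positivity)]
  exact lintegral_law_le hq hM (by simpa using h1.aemeasurable.ennreal_ofReal)

theorem memLp_two_of_isPdf {q : ℝ → ℝ} (hq : IsPdf q) {M : ℝ} (hM : ∀ x, q x ≤ M) :
    MemLp (fun x => (q x : ℂ)) 2 := by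
  rw [memLp_two_iff_integrable_sq_norm hq.integrable.ofReal.1]
  refine (hq.integrable.const_mul M).mono' (hq.integrable.ofReal.1.norm.pow 2)
    (Eventually.of_forall fun x => ?_)
  have h0 := hq.nonneg x
  simp only [Complex.norm_real, norm_pow, norm_norm]
  rw [Real.norm_of_nonneg h0, sq]
  exact mul_le_mul_of_nonneg_right (hM x) h0

/-- This is Parseval for `q` in L¹ ∩ L², a bounded density being square integrable. Fubini is not
available, because `r` need not be integrable. -/
theorem integral_plancherelKernel {q : ℝ → ℝ} (hq : IsPdf q) {M : ℝ} (hM : ∀ x, q x ≤ M)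
    {r : ℝ → ℂ} (hr : MemLp r 2) :
    ∫ y, plancherelKernel r y ∂(law q) = (2 * Real.pi : ℂ)⁻¹ * ∫ ω, ft q ω * r ω := by
  have hR := memLp_comp_two_pi_mul hr
  have hqC : Integrable fun x => (q x : ℂ) := hq.integrable.ofReal
  have h := integral_conj_mul_fourierInv hqC (memLp_two_of_isPdf hq hM) hR
  rw [← plancherelKernel_eq hR] at h
  rw [integral_law hq, ← integral_comp_two_pi_mul]
  simp only [conj_fourier_ofReal, Complex.conj_ofReal] at h
  rw [← h]
  congr 1 with y
  ring

/-! ### The estimator as a sample mean, and its bias and variance -/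

/-- Where the estimator is an ordinary integral, its kernel agrees with the Plancherel kernel only
almost everywhere. Absolute continuity of `ν` ensures that the observations avoid the exceptional
set, so both branches of the definition can be treated as one sample mean. -/
theorem estimator_ae_eq {g : ℝ → ℝ} {φs : ℝ → ℂ} {h : ℝ} (hr : MemLp (cutoffRatio g φs h) 2)
    {ν : Measure ℝ} [IsProbabilityMeasure ν] (hν : ν ≪ volume) (n : ℕ) :
    (fun Y : Fin n → ℝ => estimator g φs h Y) =ᵐ[Measure.pi fun _ => ν]
      fun Y => (n : ℂ)⁻¹ * ∑ j, plancherelKernel (cutoffRatio g φs h) (Y j) := by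
  by_cases hi : Integrable (cutoffRatio g φs h)
  · have hR := memLp_comp_two_pi_mul hr
    have h1 : plancherelKernel (cutoffRatio g φs h) =ᵐ[ν]
        𝓕⁻ (fun x : ℝ => cutoffRatio g φs h (2 * Real.pi * x)) := by
      rw [plancherelKernel_eq hR]
      exact hν.ae_le (Lp_fourierInv_toLp_ae (hi.comp_mul_left' (by positivity)) hR)
    have h2 : ∀ᵐ Y ∂(Measure.pi fun _ : Fin n => ν), ∀ j,
        plancherelKernel (cutoffRatio g φs h) (Y j) =
          𝓕⁻ (fun x : ℝ => cutoffRatio g φs h (2 * Real.pi * x)) (Y j) := by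
      rw [ae_all_iff]
      intro j
      exact (measurePreserving_eval (fun _ : Fin n => ν) j).quasiMeasurePreserving.ae h1
    filter_upwards [h2] with Y hY
    simp only [hY, fourierInv_comp_two_pi_mul]
    rw [estimator, if_pos hi]
    simp only [empFt]
    rw [← Finset.mul_sum, ← integral_finsetSum, mul_left_comm, ← integral_const_mul (n : ℂ)⁻¹]
    · simp only [mul_assoc, Finset.sum_mul]
    · intro j _
      refine hi.bdd_mul (c := 1) (by fun_prop) (Eventually.of_forall fun ω => ?_)
      rw [mul_comm Complex.I, Complex.norm_exp_ofReal_mul_I]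
  · refine Eventually.of_forall fun Y => ?_
    simp only [estimator]
    rw [if_neg hi]

/-- The bias-variance bound on the worst-case risk of the cut-off estimator. -/
theorem worstRisk_le {F : Set (ℝ → ℝ)} (hF : ∀ f ∈ F, IsPdf f) {g : ℝ → ℝ} (hg : IsPdf g) {M : ℝ}
    (hM : ∀ x, g x ≤ M) (hg0 : ∀ ω, ft g ω ≠ 0) {Φ : (ℝ → ℝ) → ℂ} {φs : ℝ → ℂ}
    (hΦ : IsRepresentedOn F Φ φs) {h : ℝ} (hr : MemLp (cutoffRatio g φs h) 2) {β : ℝ}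
    (hβ : ∀ f ∈ F, ∫ ω in {ω : ℝ | 1 < h * |ω|}, ‖ft f ω * φs (-ω)‖ ≤ β) {n : ℕ} (hn : 0 < n) :
    worstRisk F g Φ φs n h ≤ ENNReal.ofReal
      ((n : ℝ)⁻¹ * (M * ((2 * Real.pi)⁻¹ * ∫ ω, ‖cutoffRatio g φs h ω‖ ^ 2)) +
        ((2 * Real.pi)⁻¹ * β) ^ 2) := by
  refine iSup₂_le fun f hf => ?_
  obtain ⟨q, hq, hqM, hlaw⟩ := exists_isPdf_law_eq_sumLaw (hF f hf) hg hM
  have := hq.isProbabilityMeasure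
  set r := cutoffRatio g φs h with hrdef
  have hk := memLp_plancherelKernel hr
  rw [sampleLaw_eq, hlaw]
  have hae := estimator_ae_eq hr (law_absolutelyContinuous q) n
  rw [lintegral_congr_ae (g := fun Y => ‖(n : ℂ)⁻¹ * ∑ j, plancherelKernel r (Y j) - Φ f‖ₑ ^ 2)]
  swap
  · filter_upwards [hae] with Y hY
    rw [hY]
  refine (lintegral_sample_mean_sub_sq (memLp_two_law hq hqM hk) hn _).trans ?_
  apply ENNReal.ofReal_le_ofReal
  have hM0 : 0 ≤ M := (hg.nonneg 0).trans (hM 0)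
  gcongr
  · rw [← integral_norm_sq_plancherelKernel hr]
    exact integral_norm_sq_law_le hq hqM hk
  · obtain ⟨hint, hΦf⟩ := hΦ f hf
    rw [integral_plancherelKernel hq hqM hr, hΦf, ← mul_sub, norm_mul]
    have h2 : ‖(2 * Real.pi : ℂ)⁻¹‖ = (2 * Real.pi)⁻¹ := by
      rw [norm_inv, norm_mul, Complex.norm_real, Real.norm_of_nonneg Real.pi_pos.le]; simp
    rw [h2]
    refine mul_le_mul_of_nonneg_left ?_ (by positivity)
    have hS : MeasurableSet {ω : ℝ | 1 < h * |ω|} :=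
      measurableSet_lt measurable_const (by fun_prop)
    -- The factor `g*` in `q* = f* g*` cancels the denominator of `r`: the mean of the estimator is
    -- the representation of `Φ f` cut off at `h|ω| ≤ 1`, and the bias is minus the tail.
    have hq' : ∀ ω, ft q ω * r ω =
        {ω : ℝ | 1 < h * |ω|}ᶜ.indicator (fun ω => ft f ω * φs (-ω)) ω := fun ω => by
      have h3 : ft q ω = ft f ω * ft g ω := by
        rw [← charFun_law hq, ← hlaw, charFun_sumLaw (hF f hf) hg]
      rw [h3, hrdef]
      simp only [cutoffRatio, Set.indicator, Set.mem_compl_iff, Set.mem_ofPred_eq, not_lt]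
      split_ifs
      · have := hg0 ω
        field_simp
      · simp
    simp only [hq']
    rw [integral_indicator hS.compl, ← integral_add_compl hS hint, sub_add_cancel_right, norm_neg]
    exact (norm_integral_le_integral_norm _).trans (hβ f hf)

/-! ### Integrals of power-exponential weights -/

theorem lintegral_comp_abs {v : ℝ → ℝ≥0∞} (hv : Measurable v) :
    ∫⁻ ω : ℝ, v |ω| = 2 * ∫⁻ t in Set.Ioi (0 : ℝ), v t := by
  have h1 : ∫⁻ ω in Set.Ioi (0 : ℝ), v |ω| = ∫⁻ t in Set.Ioi (0 : ℝ), v t :=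
    setLIntegral_congr_fun measurableSet_Ioi fun ω hω => by
      simp only [abs_of_pos (Set.mem_Ioi.1 hω)]
  have h2 : ∫⁻ ω in Set.Iic (0 : ℝ), v |ω| = ∫⁻ t in Set.Ioi (0 : ℝ), v t := by
    have h3 := (Measure.measurePreserving_neg (volume : Measure ℝ)).setLIntegral_comp_preimage
      (s := Set.Ici (0 : ℝ)) measurableSet_Ici hv
    have h4 : (Neg.neg : ℝ → ℝ) ⁻¹' Set.Ici (0 : ℝ) = Set.Iic 0 := by ext; simp
    rw [h4] at h3
    rw [← setLIntegral_congr (Ioi_ae_eq_Ici (a := (0 : ℝ)) (μ := volume)).symm, ← h3]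
    exact setLIntegral_congr_fun measurableSet_Iic fun ω hω => by
      simp only [abs_of_nonpos (Set.mem_Iic.1 hω)]
  rw [← lintegral_add_compl (fun ω : ℝ => v |ω|) (measurableSet_Ioi (a := (0 : ℝ))),
    Set.compl_Ioi, h1, h2, two_mul]

theorem setLIntegral_comp_abs {v : ℝ → ℝ≥0∞} (hv : Measurable v) {S : Set ℝ}
    (hS : MeasurableSet S) :
    ∫⁻ ω in {ω : ℝ | |ω| ∈ S}, v |ω| = 2 * ∫⁻ t in Set.Ioi (0 : ℝ) ∩ S, v t := by
  have hS' : MeasurableSet {ω : ℝ | |ω| ∈ S} := hS.preimage continuous_abs.measurable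
  rw [← lintegral_indicator hS', Set.inter_comm, ← Measure.restrict_restrict hS,
    ← lintegral_indicator hS, ← lintegral_comp_abs (hv.indicator hS)]
  rfl

/-- Integrate `c u ≤ F'`; the integrability of `F'` is automatic because `F' ≥ 0`. -/
theorem setLIntegral_Ioc_le_of_hasDerivAt {F F' u : ℝ → ℝ} {t₀ T c : ℝ} (hT : t₀ ≤ T) (hc : 0 < c)
    (hF : ∀ t, t₀ ≤ t → HasDerivAt F (F' t) t) (hu : ∀ t, t₀ ≤ t → 0 ≤ u t)
    (hcu : ∀ t, t₀ ≤ t → c * u t ≤ F' t) :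
    ∫⁻ t in Set.Ioc t₀ T, ENNReal.ofReal (u t) ≤ ENNReal.ofReal ((F T - F t₀) / c) := by
  have hcont : ContinuousOn F (Set.Icc t₀ T) := fun t ht =>
    (hF t ht.1).continuousAt.continuousWithinAt
  have hd : ∀ t ∈ Set.Ioo t₀ T, HasDerivAt F (F' t) t := fun t ht => hF t ht.1.le
  have hnn : ∀ t, t₀ ≤ t → 0 ≤ F' t := fun t ht =>
    (mul_nonneg hc.le (hu t ht)).trans (hcu t ht)
  have hint : IntegrableOn F' (Set.Ioc t₀ T) :=
    intervalIntegral.integrableOn_deriv_of_nonneg hcont hd fun t ht => hnn t ht.1.le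
  have hftc := intervalIntegral.integral_eq_sub_of_hasDerivAt_of_le hT hcont hd
    ((intervalIntegrable_iff_integrableOn_Ioc_of_le hT).2 hint)
  rw [intervalIntegral.integral_of_le hT] at hftc
  rw [← hftc, div_eq_inv_mul, ← integral_const_mul,
    ofReal_integral_eq_lintegral_ofReal (hint.const_mul _)]
  · refine setLIntegral_mono' measurableSet_Ioc fun t ht => ENNReal.ofReal_le_ofReal ?_
    rw [le_inv_mul_iff₀ hc]
    exact hcu t ht.1.le
  · refine (ae_restrict_iff' measurableSet_Ioc).2 (Eventually.of_forall fun t ht => ?_)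
    exact mul_nonneg (by positivity) (hnn t ht.1.le)

/-- The previous bound applied to `-F` on `(t₀, t₀ + k]`; `F ≥ 0` allows the end value to be
dropped, and monotone convergence lets `k` tend to infinity. -/
theorem setLIntegral_Ioi_le_of_hasDerivAt {F F' u : ℝ → ℝ} {t₀ c : ℝ} (hc : 0 < c)
    (hF : ∀ t, t₀ ≤ t → HasDerivAt F (F' t) t) (hu : ∀ t, t₀ ≤ t → 0 ≤ u t)
    (hcu : ∀ t, t₀ ≤ t → c * u t ≤ -F' t) (hF0 : ∀ t, t₀ ≤ t → 0 ≤ F t) :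
    ∫⁻ t in Set.Ioi t₀, ENNReal.ofReal (u t) ≤ ENNReal.ofReal (F t₀ / c) := by
  have hU : Set.Ioi t₀ = ⋃ k : ℕ, Set.Ioc t₀ (t₀ + k) := by
    ext t
    simp only [Set.mem_Ioi, Set.mem_iUnion, Set.mem_Ioc]
    refine ⟨fun h => ?_, fun ⟨_, h, _⟩ => h⟩
    obtain ⟨k, hk⟩ := exists_nat_ge (t - t₀)
    exact ⟨k, h, by linarith⟩
  have hmono : Monotone fun k : ℕ => Set.Ioc t₀ (t₀ + k) := fun i j hij =>
    Set.Ioc_subset_Ioc_right (by gcongr)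
  rw [hU, setLIntegral_iUnion_of_directed _ hmono.directed_le]
  refine iSup_le fun k => ?_
  have hk : t₀ ≤ t₀ + (k : ℝ) := by simp
  refine (setLIntegral_Ioc_le_of_hasDerivAt (F := fun t => -F t) (F' := fun t => -F' t)
    hk hc (fun t ht => (hF t ht).neg) hu hcu).trans (ENNReal.ofReal_le_ofReal ?_)
  gcongr
  linarith [hF0 _ hk]

/-- `(t² + 1)^p exp(P t^x + Q t^y)`. -/
noncomputable def weight (p P x Q y t : ℝ) : ℝ :=
  (t ^ 2 + 1) ^ p * Real.exp (P * t ^ x + Q * t ^ y)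

/-- `t^(2p+1-x) exp(P t^x + Q t^y)`. -/
noncomputable def primitiveWeight (p P x Q y t : ℝ) : ℝ :=
  t ^ (2 * p + 1 - x) * Real.exp (P * t ^ x + Q * t ^ y)

/-- The logarithmic derivative of `primitiveWeight`, up to the factor `t^(x-1)`. -/
noncomputable def growthFactor (p P x Q y t : ℝ) : ℝ :=
  (2 * p + 1 - x) * t ^ (-x) + P * x + Q * y * t ^ (y - x)

theorem weight_nonneg (p P x Q y t : ℝ) : 0 ≤ weight p P x Q y t := by
  unfold weight; positivity

theorem measurable_weight (p P x Q y : ℝ) : Measurable (weight p P x Q y) := by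
  unfold weight; fun_prop

theorem continuous_weight (p P Q : ℝ) {x y : ℝ} (hx : 0 ≤ x) (hy : 0 ≤ y) :
    Continuous (weight p P x Q y) := by
  unfold weight
  have h1 : Continuous fun t : ℝ => t ^ x := Real.continuous_rpow_const hx
  have h2 : Continuous fun t : ℝ => t ^ y := Real.continuous_rpow_const hy
  have h3 : Continuous fun t : ℝ => (t ^ 2 + 1) ^ p :=
    Continuous.rpow_const (by fun_prop) fun t => Or.inl (by positivity)
  fun_prop

theorem primitiveWeight_pos (p P x Q y : ℝ) {t : ℝ} (ht : 0 < t) :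
    0 < primitiveWeight p P x Q y t := by
  unfold primitiveWeight; positivity

/-- The power `2p+1-x` compensates the factor `t^(x-1)` produced by differentiating `exp(P t^x)`.
The main part `t^(2p) exp(...)` of the weight is then recovered up to `growthFactor`, which has a
finite limit in the cases used. -/
theorem hasDerivAt_primitiveWeight (p P x Q y : ℝ) {t : ℝ} (ht : 0 < t) :
    HasDerivAt (primitiveWeight p P x Q y)
      (t ^ (2 * p) * Real.exp (P * t ^ x + Q * t ^ y) * growthFactor p P x Q y t) t := by
  have h1 := Real.hasDerivAt_rpow_const (p := 2 * p + 1 - x) (Or.inl ht.ne')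
  have h2 := ((Real.hasDerivAt_rpow_const (p := x) (Or.inl ht.ne')).const_mul P).add
    ((Real.hasDerivAt_rpow_const (p := y) (Or.inl ht.ne')).const_mul Q)
  refine (h1.mul h2.exp).congr_deriv ?_
  have e1 : t ^ (2 * p + 1 - x - 1) = t ^ (2 * p) * t ^ (-x) := by
    rw [← Real.rpow_add ht]; ring_nf
  have e2 : t ^ (2 * p + 1 - x) * t ^ (x - 1) = t ^ (2 * p) := by
    rw [← Real.rpow_add ht]; ring_nf
  have e3 : t ^ (2 * p + 1 - x) * t ^ (y - 1) = t ^ (2 * p) * t ^ (y - x) := by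
    rw [← Real.rpow_add ht, ← Real.rpow_add ht]; ring_nf
  simp only [growthFactor, e1, Pi.add_apply]
  linear_combination (Real.exp (P * t ^ x + Q * t ^ y) * P * x) * e2 +
    (Real.exp (P * t ^ x + Q * t ^ y) * Q * y) * e3

theorem sq_add_one_rpow_le (p : ℝ) {t : ℝ} (ht : 1 ≤ t) :
    (t ^ 2 + 1) ^ p ≤ 2 ^ |p| * t ^ (2 * p) := by
  have ht0 : 0 < t := by linarith
  have e : t ^ (2 * p) = (t ^ 2) ^ p := by
    rw [Real.rpow_mul ht0.le]; norm_num
  rw [e]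
  rcases le_or_gt 0 p with hp | hp
  · rw [abs_of_nonneg hp, ← Real.mul_rpow (by norm_num) (by positivity)]
    exact Real.rpow_le_rpow (by positivity) (by nlinarith) hp
  · calc (t ^ 2 + 1) ^ p ≤ (t ^ 2) ^ p :=
          Real.rpow_le_rpow_of_nonpos (by positivity) (by linarith) hp.le
      _ ≤ 2 ^ |p| * (t ^ 2) ^ p :=
          le_mul_of_one_le_left (by positivity) (Real.one_le_rpow (by norm_num) (abs_nonneg _))

theorem weight_le (p P x Q y : ℝ) {t : ℝ} (ht : 1 ≤ t) :
    weight p P x Q y t ≤ 2 ^ |p| * (t ^ (2 * p) * Real.exp (P * t ^ x + Q * t ^ y)) := by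
  unfold weight
  rw [← mul_assoc]
  gcongr
  exact sq_add_one_rpow_le p ht

theorem exists_setLIntegral_Ioc_weight_le (p P Q : ℝ) {x y : ℝ} (hx : 0 ≤ x) (hy : 0 ≤ y)
    (T : ℝ) :
    ∃ C : ℝ, 0 ≤ C ∧ ∫⁻ t in Set.Ioc 0 T, ENNReal.ofReal (weight p P x Q y t) ≤
      ENNReal.ofReal C := by
  have hint : IntegrableOn (weight p P x Q y) (Set.Ioc 0 T) :=
    ((continuous_weight p P Q hx hy).integrableOn_Icc (a := 0) (b := T)).mono_set
      Set.Ioc_subset_Icc_self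
  refine ⟨∫ t in Set.Ioc 0 T, weight p P x Q y t,
    integral_nonneg fun t => weight_nonneg _ _ _ _ _ _, ?_⟩
  rw [ofReal_integral_eq_lintegral_ofReal hint
    (Eventually.of_forall fun t => weight_nonneg _ _ _ _ _ _)]

/-- For `κ < 0` the comparison function decreases eventually, and its value at `T` controls the
whole tail. -/
theorem exists_setLIntegral_Ioi_weight_le (p P Q : ℝ) {x y κ : ℝ} (hκ : κ < 0)
    (hk : Tendsto (growthFactor p P x Q y) atTop (𝓝 κ)) :
    ∃ C t₀ : ℝ, 0 < C ∧ 1 ≤ t₀ ∧ ∀ T, t₀ ≤ T →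
      ∫⁻ t in Set.Ioi T, ENNReal.ofReal (weight p P x Q y t) ≤
        ENNReal.ofReal (C * primitiveWeight p P x Q y T) := by
  obtain ⟨t₁, ht₁⟩ := eventually_atTop.1 (hk.eventually (gt_mem_nhds (show κ < κ / 2 by linarith)))
  refine ⟨2 ^ |p| / (-κ / 2), max 1 t₁, div_pos (by positivity) (by linarith), le_max_left _ _,
    fun T hT => ?_⟩
  have hT1 : 1 ≤ T := (le_max_left _ _).trans hT
  have hTt : t₁ ≤ T := (le_max_right _ _).trans hT
  -- The growth factor is eventually below `κ/2`, and `2^|p|` is the price of replacing `t² + 1` by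
  -- `t²`.
  set c : ℝ := (-κ / 2) / 2 ^ |p| with hcdef
  have hc : 0 < c := div_pos (by linarith) (by positivity)
  have h := setLIntegral_Ioi_le_of_hasDerivAt (t₀ := T) (u := weight p P x Q y) hc
    (fun t ht => hasDerivAt_primitiveWeight p P x Q y (by linarith : (0 : ℝ) < t))
    (fun t _ => weight_nonneg _ _ _ _ _ t) (fun t ht => ?_)
    (fun t ht => (primitiveWeight_pos p P x Q y (by linarith)).le)
  · refine h.trans (ENNReal.ofReal_le_ofReal (le_of_eq ?_))
    rw [hcdef]; field_simp
  · have hw := weight_le p P x Q y (hT1.trans ht)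
    have hg := ht₁ t (hTt.trans ht)
    set A := t ^ (2 * p) * Real.exp (P * t ^ x + Q * t ^ y)
    have hA : 0 ≤ A := by
      have : 0 ≤ t := by linarith
      positivity
    calc c * weight p P x Q y t ≤ c * (2 ^ |p| * A) := by gcongr
      _ = (-κ / 2) * A := by rw [hcdef]; field_simp
      _ ≤ -(A * growthFactor p P x Q y t) := by nlinarith

/-- For `κ > 0` the comparison function `F` increases from some `t₀` on, so its end value dominates
the integral. -/
theorem exists_setLIntegral_Ioc_weight_le_primitiveWeight (p P Q : ℝ) {x y κ : ℝ} (hx : 0 ≤ x)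
    (hy : 0 ≤ y) (hκ : 0 < κ) (hk : Tendsto (growthFactor p P x Q y) atTop (𝓝 κ)) :
    ∃ C t₀ : ℝ, 0 < C ∧ 1 ≤ t₀ ∧ ∀ T, t₀ ≤ T →
      ∫⁻ t in Set.Ioc 0 T, ENNReal.ofReal (weight p P x Q y t) ≤
        ENNReal.ofReal (C * primitiveWeight p P x Q y T) := by
  obtain ⟨t₁, ht₁⟩ := eventually_atTop.1 (hk.eventually (lt_mem_nhds (show κ / 2 < κ by linarith)))
  set t₀ := max 1 t₁
  have h01 : 1 ≤ t₀ := le_max_left _ _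
  set F := primitiveWeight p P x Q y
  have hF0 : 0 < F t₀ := primitiveWeight_pos p P x Q y (by linarith)
  obtain ⟨C₀, hC₀, hI₀⟩ := exists_setLIntegral_Ioc_weight_le p P Q hx hy t₀
  set c : ℝ := (κ / 2) / 2 ^ |p| with hcdef
  have hc : 0 < c := div_pos (by linarith) (by positivity)
  -- As `F T ≥ F t₀ > 0`, the first term absorbs the integral over `(0, t₀]`; the second covers
  -- `(t₀, T]`.
  refine ⟨C₀ / F t₀ + 1 / c, t₀, by positivity, h01, fun T hT => ?_⟩
  have h := setLIntegral_Ioc_le_of_hasDerivAt (F := F) (t₀ := t₀) (T := T)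
    (u := weight p P x Q y) hT hc
    (fun t ht => hasDerivAt_primitiveWeight p P x Q y (by linarith : (0 : ℝ) < t))
    (fun t _ => weight_nonneg _ _ _ _ _ t) (fun t ht => ?_)
  · have hnn : 0 ≤ (F T - F t₀) / c := by
      have hmono : MonotoneOn F (Set.Ici t₀) := by
        refine monotoneOn_of_deriv_nonneg (convex_Ici _) (fun t ht => ?_) (fun t ht => ?_)
          fun t ht => ?_
        · exact (hasDerivAt_primitiveWeight p P x Q y
            (by linarith [Set.mem_Ici.1 ht] : (0 : ℝ) < t)).continuousAt.continuousWithinAt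
        · rw [interior_Ici] at ht
          exact (hasDerivAt_primitiveWeight p P x Q y (by linarith [Set.mem_Ioi.1 ht] :
            (0 : ℝ) < t)).differentiableAt.differentiableWithinAt
        · rw [interior_Ici] at ht
          have ht' := Set.mem_Ioi.1 ht
          have ht0 : 0 < t := by linarith
          rw [(hasDerivAt_primitiveWeight p P x Q y ht0).deriv]
          have := ht₁ t ((le_max_right _ _).trans ht'.le)
          exact mul_nonneg (by positivity) (by linarith)
      have := hmono (Set.mem_Ici.2 le_rfl) (Set.mem_Ici.2 hT) hT
      exact div_nonneg (by linarith) hc.le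
    rw [← Set.Ioc_union_Ioc_eq_Ioc (by linarith : (0 : ℝ) ≤ t₀) hT]
    refine (lintegral_union_le _ _ _).trans ((add_le_add hI₀ h).trans ?_)
    rw [← ENNReal.ofReal_add hC₀ hnn]
    apply ENNReal.ofReal_le_ofReal
    have hle : F t₀ ≤ F T := by
      have := (div_nonneg_iff.1 hnn)
      rcases this with h | h <;> linarith
    have e1 : C₀ ≤ C₀ / F t₀ * F T := by
      rw [div_mul_eq_mul_div, le_div_iff₀ hF0]; gcongr
    have e2 : (F T - F t₀) / c ≤ 1 / c * F T := by
      rw [div_mul_eq_mul_div, one_mul]; gcongr; linarith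
    linarith
  · have hw := weight_le p P x Q y (h01.trans ht)
    have hg := ht₁ t ((le_max_right _ _).trans ht)
    set A := t ^ (2 * p) * Real.exp (P * t ^ x + Q * t ^ y)
    have hA : 0 ≤ A := by
      have : 0 ≤ t := by linarith
      positivity
    calc c * weight p P x Q y t ≤ c * (2 ^ |p| * A) := by gcongr
      _ = (κ / 2) * A := by rw [hcdef]; field_simp
      _ ≤ A * growthFactor p P x Q y t := by nlinarith

/-! ### Uniform boundedness on the Sobolev ball -/

/-- This is Fatou's lemma along a convergent sequence: pointwise continuity of the integrand
suffices, without domination. -/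
theorem isClosed_setOf_lintegral_le {X : Type*} [PseudoMetricSpace X] {H : X → ℝ → ℝ≥0∞}
    (hm : ∀ u, Measurable (H u)) (hc : ∀ ω, Continuous fun u => H u ω) (c : ℝ≥0∞) :
    IsClosed {u | ∫⁻ ω, H u ω ≤ c} := by
  refine IsSeqClosed.isClosed fun u v hu huv => ?_
  have h1 : ∀ ω, H v ω = liminf (fun k => H (u k) ω) atTop := fun ω =>
    (((hc ω).tendsto v).comp huv).liminf_eq.symm
  calc ∫⁻ ω, H v ω = ∫⁻ ω, liminf (fun k => H (u k) ω) atTop := lintegral_congr h1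
    _ ≤ liminf (fun k => ∫⁻ ω, H (u k) ω) atTop := lintegral_liminf_le fun k => hm _
    _ ≤ c := liminf_le_of_frequently_le' (Frequently.of_forall hu)

theorem integrable_exp_mul {t : ℝ → ℝ} (ht : Integrable t) (ω : ℝ) :
    Integrable fun x : ℝ => Complex.exp (Complex.I * (ω * x : ℝ)) * (t x : ℂ) := by
  refine ht.ofReal.bdd_mul (c := 1) (by fun_prop) (Eventually.of_forall fun x => ?_)
  rw [mul_comm Complex.I, Complex.norm_exp_ofReal_mul_I]

theorem norm_ft_le (t : ℝ → ℝ) (ω : ℝ) : ‖ft t ω‖ ≤ ∫ x, ‖t x‖ := by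
  refine (norm_integral_le_integral_norm _).trans (le_of_eq ?_)
  congr 1 with x
  rw [norm_mul, mul_comm Complex.I, Complex.norm_exp_ofReal_mul_I, one_mul, Complex.norm_real]

theorem ft_congr_ae {t u : ℝ → ℝ} (h : t =ᵐ[volume] u) (ω : ℝ) : ft t ω = ft u ω := by
  refine integral_congr_ae ?_
  filter_upwards [h] with x hx
  rw [hx]

theorem ft_linear_comb {t u : ℝ → ℝ} (ht : Integrable t) (hu : Integrable u) (a b ω : ℝ) :
    ft (fun x => a * t x + b * u x) ω = a * ft t ω + b * ft u ω := by
  unfold ft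
  rw [← integral_const_mul, ← integral_const_mul,
    ← integral_add ((integrable_exp_mul ht ω).const_mul _) ((integrable_exp_mul hu ω).const_mul _)]
  congr 1 with x
  push_cast; ring

theorem continuous_ft_of_integrable {t : ℝ → ℝ} (ht : Integrable t) : Continuous (ft t) := by
  refine continuous_of_dominated (bound := fun x => ‖t x‖)
    (fun ω => (integrable_exp_mul ht ω).1) (fun ω => Eventually.of_forall fun x => ?_) ht.norm
    (Eventually.of_forall fun x => by fun_prop)
  rw [norm_mul, mul_comm Complex.I, Complex.norm_exp_ofReal_mul_I, one_mul, Complex.norm_real]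

theorem ft_Lp_linear_comb (u v : Lp ℝ 1 (volume : Measure ℝ)) (a b ω : ℝ) :
    ft (a • u + b • v : Lp ℝ 1 (volume : Measure ℝ)) ω = a * ft u ω + b * ft v ω := by
  rw [← ft_linear_comb (L1.integrable_coeFn u) (L1.integrable_coeFn v)]
  apply ft_congr_ae
  filter_upwards [Lp.coeFn_add (a • u) (b • v), Lp.coeFn_smul a u, Lp.coeFn_smul b v]
    with x h1 h2 h3
  rw [h1, Pi.add_apply, h2, h3]; rfl

theorem continuous_ft_Lp (ω : ℝ) :
    Continuous fun u : Lp ℝ 1 (volume : Measure ℝ) => ft u ω := by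
  have : LipschitzWith 1 fun u : Lp ℝ 1 (volume : Measure ℝ) => ft u ω := by
    refine LipschitzWith.of_dist_le_mul fun u v => ?_
    have h := ft_Lp_linear_comb u v 1 (-1) ω
    rw [one_smul, neg_one_smul, ← sub_eq_add_neg] at h
    have h2 := norm_ft_le (u - v : Lp ℝ 1 (volume : Measure ℝ)) ω
    rw [h] at h2
    rw [dist_eq_norm, dist_eq_norm, L1.norm_eq_integral_norm, NNReal.coe_one, one_mul]
    refine (le_of_eq ?_).trans h2
    push_cast; congr 1; ring
  exact this.continuous

/-- The classes in `L¹` of the densities in `sobolevBall s B`. -/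
def sobolevBallLp (s B : ℝ) : Set (Lp ℝ 1 (volume : Measure ℝ)) :=
  {u | 0 ≤ u} ∩ {u | ∫ x, u x = 1} ∩
    {u | ∫⁻ ω : ℝ, ENNReal.ofReal (‖ft u ω‖ ^ 2 * (ω ^ 2 + 1) ^ s) ≤ ENNReal.ofReal (B ^ 2)}

theorem measurable_sobolev_integrand (s : ℝ) {t : ℝ → ℝ} (ht : Integrable t) :
    Measurable fun ω : ℝ => ENNReal.ofReal (‖ft t ω‖ ^ 2 * (ω ^ 2 + 1) ^ s) := by
  have := (continuous_ft_of_integrable ht).measurable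
  fun_prop

/-- Closedness in L¹ makes the ball a complete metric space, as Baire's theorem requires. -/
theorem isClosed_sobolevBallLp (s B : ℝ) : IsClosed (sobolevBallLp s B) := by
  refine (IsClosed.inter ?_ ?_).inter ?_
  · exact isClosed_le continuous_const continuous_id
  · exact isClosed_eq continuous_integral continuous_const
  · refine isClosed_setOf_lintegral_le
      (fun u => measurable_sobolev_integrand s (L1.integrable_coeFn u)) (fun ω => ?_) _
    have := continuous_ft_Lp ω
    exact ENNReal.continuous_ofReal.comp (by fun_prop)

theorem toL1_mem_sobolevBallLp {s B : ℝ} {f : ℝ → ℝ} (hf : f ∈ sobolevBall s B) :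
    hf.1.integrable.toL1 f ∈ sobolevBallLp s B := by
  have hae := hf.1.integrable.coeFn_toL1
  refine ⟨⟨?_, ?_⟩, ?_⟩
  · rw [Set.mem_ofPred_eq, ← Lp.coeFn_nonneg]
    filter_upwards [hae] with x hx
    rw [hx]; exact hf.1.nonneg x
  · rw [Set.mem_ofPred_eq, integral_congr_ae hae,
      integral_eq_lintegral_of_nonneg_ae (Eventually.of_forall hf.1.nonneg) hf.1.integrable.1,
      hf.1.lintegral_eq_one, ENNReal.toReal_one]
  · simpa only [Set.mem_ofPred_eq, ft_congr_ae hae] using hf.2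

theorem exists_mem_sobolevBall_ae_eq {s B : ℝ} {u : Lp ℝ 1 (volume : Measure ℝ)}
    (hu : u ∈ sobolevBallLp s B) : ∃ f ∈ sobolevBall s B, f =ᵐ[volume] u := by
  obtain ⟨⟨h0, h1⟩, h2⟩ := hu
  rw [Set.mem_ofPred_eq, ← Lp.coeFn_nonneg] at h0
  have hm : Measurable (u : ℝ → ℝ) := (Lp.stronglyMeasurable u).measurable
  -- A class in L¹ is nonnegative only almost everywhere; the positive part of a representative is
  -- nonnegative at every point, as `IsPdf` demands.
  have hae : (fun x => max (u x) 0) =ᵐ[volume] u := by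
    filter_upwards [h0] with x hx
    exact max_eq_left hx
  refine ⟨fun x => max (u x) 0, ⟨⟨hm.max measurable_const, fun x => le_max_right _ _, ?_⟩, ?_⟩, hae⟩
  · rw [lintegral_congr_ae (g := fun x => ENNReal.ofReal (u x)) (by
      filter_upwards [hae] with x hx
      rw [hx]), ← ofReal_integral_eq_lintegral_ofReal (L1.integrable_coeFn u) h0, h1,
      ENNReal.ofReal_one]
  · simpa only [ft_congr_ae hae, Set.mem_ofPred_eq] using h2

theorem norm_eq_one_of_mem_sobolevBallLp {s B : ℝ} {u : Lp ℝ 1 (volume : Measure ℝ)}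
    (hu : u ∈ sobolevBallLp s B) : ‖u‖ = 1 := by
  obtain ⟨⟨h0, h1⟩, -⟩ := hu
  rw [Set.mem_ofPred_eq, ← Lp.coeFn_nonneg] at h0
  rw [L1.norm_eq_integral_norm, ← h1]
  apply integral_congr_ae
  filter_upwards [h0] with x hx
  exact Real.norm_of_nonneg hx

theorem convex_sobolevBallLp (s B : ℝ) : Convex ℝ (sobolevBallLp s B) := by
  rintro u ⟨⟨hu0, hu1⟩, hu2⟩ v ⟨⟨hv0, hv1⟩, hv2⟩ a b ha hb hab
  refine ⟨⟨?_, ?_⟩, ?_⟩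
  · rw [Set.mem_ofPred_eq, ← Lp.coeFn_nonneg] at hu0 hv0 ⊢
    filter_upwards [Lp.coeFn_add (a • u) (b • v), Lp.coeFn_smul a u, Lp.coeFn_smul b v, hu0, hv0]
      with x h1 h2 h3 h4 h5
    rw [h1, Pi.add_apply, h2, h3]
    exact add_nonneg (mul_nonneg ha h4) (mul_nonneg hb h5)
  · rw [Set.mem_ofPred_eq] at hu1 hv1 ⊢
    have : ∫ x, (a • u + b • v : Lp ℝ 1 (volume : Measure ℝ)) x = ∫ x, (a * u x + b * v x) := by
      apply integral_congr_ae
      filter_upwards [Lp.coeFn_add (a • u) (b • v), Lp.coeFn_smul a u, Lp.coeFn_smul b v]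
        with x h1 h2 h3
      rw [h1, Pi.add_apply, h2, h3]; rfl
    rw [this, integral_add ((L1.integrable_coeFn u).const_mul _)
      ((L1.integrable_coeFn v).const_mul _), integral_const_mul, integral_const_mul, hu1, hv1]
    linarith
  · rw [Set.mem_ofPred_eq] at hu2 hv2 ⊢
    have mu := measurable_sobolev_integrand s (L1.integrable_coeFn u)
    have mv := measurable_sobolev_integrand s (L1.integrable_coeFn v)
    calc ∫⁻ ω : ℝ, ENNReal.ofReal
          (‖ft (a • u + b • v : Lp ℝ 1 (volume : Measure ℝ)) ω‖ ^ 2 * (ω ^ 2 + 1) ^ s)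
        ≤ ∫⁻ ω : ℝ, (ENNReal.ofReal a * ENNReal.ofReal (‖ft u ω‖ ^ 2 * (ω ^ 2 + 1) ^ s) +
          ENNReal.ofReal b * ENNReal.ofReal (‖ft v ω‖ ^ 2 * (ω ^ 2 + 1) ^ s)) := by
          refine lintegral_mono fun ω => ?_
          rw [← ENNReal.ofReal_mul ha, ← ENNReal.ofReal_mul hb,
            ← ENNReal.ofReal_add (by positivity) (by positivity), ft_Lp_linear_comb]
          apply ENNReal.ofReal_le_ofReal
          have h1 : ‖(a : ℂ) * ft u ω + b * ft v ω‖ ≤ a * ‖ft u ω‖ + b * ‖ft v ω‖ := by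
            refine (norm_add_le _ _).trans (le_of_eq ?_)
            rw [norm_mul, norm_mul, Complex.norm_real, Complex.norm_real,
              Real.norm_of_nonneg ha, Real.norm_of_nonneg hb]
          have h2 : ‖(a : ℂ) * ft u ω + b * ft v ω‖ ^ 2 ≤ a * ‖ft u ω‖ ^ 2 + b * ‖ft v ω‖ ^ 2 := by
            refine (pow_le_pow_left₀ (norm_nonneg _) h1 2).trans ?_
            have hb' : b = 1 - a := by linarith
            subst hb'
            nlinarith [mul_nonneg (mul_nonneg ha hb) (sq_nonneg (‖ft u ω‖ - ‖ft v ω‖))]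
          calc _ ≤ (a * ‖ft u ω‖ ^ 2 + b * ‖ft v ω‖ ^ 2) * (ω ^ 2 + 1) ^ s := by gcongr
            _ = _ := by ring
      _ ≤ ENNReal.ofReal a * ENNReal.ofReal (B ^ 2) + ENNReal.ofReal b * ENNReal.ofReal (B ^ 2) := by
          rw [lintegral_add_left (by fun_prop), lintegral_const_mul _ mu, lintegral_const_mul _ mv]
          gcongr
      _ = ENNReal.ofReal (B ^ 2) := by
          rw [← add_mul, ← ENNReal.ofReal_add ha hb, hab, ENNReal.ofReal_one, one_mul]

/-- Solve `v = (1 - t) f₀ + t u` for `u`. A bound at `f₀` and at the nearby point `v` thus becomes a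
bound at an arbitrary `u`. -/
theorem enorm_ft_mul_le_of_convex_comb (u f₀ : Lp ℝ 1 (volume : Measure ℝ)) {t : ℝ} (ht : 0 < t)
    (ht1 : t ≤ 1) (ω : ℝ) (z : ℂ) :
    ‖ft u ω * z‖ₑ ≤ ENNReal.ofReal t⁻¹ *
      (‖ft ((1 - t) • f₀ + t • u : Lp ℝ 1 (volume : Measure ℝ)) ω * z‖ₑ + ‖ft f₀ ω * z‖ₑ) := by
  rw [← ofReal_norm, ← ofReal_norm, ← ofReal_norm,
    ← ENNReal.ofReal_add (norm_nonneg _) (norm_nonneg _), ← ENNReal.ofReal_mul (by positivity)]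
  apply ENNReal.ofReal_le_ofReal
  rw [le_inv_mul_iff₀ ht, ft_Lp_linear_comb]
  generalize ft f₀ ω = w
  generalize ft u ω = y
  have h2 : (t : ℂ) * y = (((1 - t : ℝ) : ℂ) * w + t * y) - ((1 - t : ℝ) : ℂ) * w := by ring
  calc t * ‖y * z‖ = ‖(t : ℂ) * y‖ * ‖z‖ := by
        rw [norm_mul, norm_mul, Complex.norm_real, Real.norm_of_nonneg ht.le, mul_assoc]
    _ ≤ (‖((1 - t : ℝ) : ℂ) * w + t * y‖ + ‖w‖) * ‖z‖ := by
        gcongr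
        refine (congrArg norm h2).le.trans ((norm_sub_le _ _).trans ?_)
        gcongr
        rw [norm_mul, Complex.norm_real, Real.norm_of_nonneg (by linarith)]
        exact mul_le_of_le_one_left (norm_nonneg _) (by linarith)
    _ = ‖(((1 - t : ℝ) : ℂ) * w + t * y) * z‖ + ‖w * z‖ := by rw [norm_mul, norm_mul]; ring

/-- A consequence of Baire's theorem: a lower semicontinuous function that is finite on a nonempty
closed set is bounded on a relatively open piece of it. -/
theorem exists_bound_near_of_isClosed {X : Type*} [MetricSpace X] [CompleteSpace X] {S : Set X}
    (hS : IsClosed S) (hne : S.Nonempty) {p : X → ℝ≥0∞} (hp : ∀ m : ℝ≥0∞, IsClosed {u | p u ≤ m})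
    (hfin : ∀ u ∈ S, p u < ∞) :
    ∃ m : ℕ, ∃ f₀ ∈ S, ∃ r > 0, ∀ u ∈ S, dist u f₀ < r → p u ≤ m := by
  have : CompleteSpace S := hS.completeSpace_coe
  have : Nonempty S := hne.to_subtype
  obtain ⟨m, ⟨f₀, hf₀⟩⟩ := nonempty_interior_of_iUnion_of_closed
    (f := fun m : ℕ => {u : S | p u ≤ m})
    (fun m => (hp m).preimage continuous_subtype_val) (by
      refine Set.eq_univ_of_forall fun u => Set.mem_iUnion.2 ?_
      obtain ⟨m, hm⟩ := ENNReal.exists_nat_gt (hfin u u.2).ne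
      exact ⟨m, hm.le⟩)
  obtain ⟨r, hr, hball⟩ := Metric.isOpen_iff.1 isOpen_interior f₀ hf₀
  refine ⟨m, f₀, f₀.2, r, hr, fun u hu hd => ?_⟩
  exact interior_subset (s := {u : S | p u ≤ m})
    (hball (show (⟨u, hu⟩ : S) ∈ Metric.ball f₀ r from hd))

/-- A uniform boundedness principle: if `∫ |f* φ*(-·)|` is finite for every `f` in a Sobolev ball,
then it is bounded on that ball. -/
theorem exists_bound_integral_norm_ft_mul {s B : ℝ} {φs : ℝ → ℂ} (hφ : Measurable φs)
    (hint : ∀ f ∈ sobolevBall s B, Integrable fun ω : ℝ => ft f ω * φs (-ω)) :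
    ∃ K : ℝ, 0 ≤ K ∧ ∀ f ∈ sobolevBall s B, ∫ ω, ‖ft f ω * φs (-ω)‖ ≤ K := by
  rcases Set.eq_empty_or_nonempty (sobolevBallLp s B) with hS | hS
  · refine ⟨0, le_rfl, fun f hf => ?_⟩
    have := toL1_mem_sobolevBallLp hf
    rw [hS] at this
    exact this.elim
  have hmeas : ∀ u : Lp ℝ 1 (volume : Measure ℝ), Measurable fun ω => ‖ft u ω * φs (-ω)‖ₑ :=
    fun u => by
      have := (continuous_ft_of_integrable (L1.integrable_coeFn u)).measurable
      fun_prop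
  obtain ⟨m, f₀, hf₀, r, hr, hball⟩ := exists_bound_near_of_isClosed (isClosed_sobolevBallLp s B)
    hS (p := fun u => ∫⁻ ω, ‖ft u ω * φs (-ω)‖ₑ)
    (fun m => isClosed_setOf_lintegral_le hmeas (fun ω => by
      have := continuous_ft_Lp ω
      fun_prop) m)
    (fun u hu => by
      obtain ⟨f, hf, hae⟩ := exists_mem_sobolevBall_ae_eq hu
      have := (hint f hf).2
      simpa only [hasFiniteIntegral_iff_enorm, ft_congr_ae hae] using this)
  have hf₀m := hball f₀ hf₀ (by simpa using hr)
  -- Two members of the ball have L¹ distance at most 2, so `t ≤ r/3` puts `(1 - t) f₀ + t u` within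
  -- `2r/3 < r` of `f₀`.
  obtain ⟨t, ht, ht1, htr⟩ : ∃ t : ℝ, 0 < t ∧ t ≤ 1 ∧ t ≤ r / 3 :=
    ⟨min 1 (r / 3), lt_min one_pos (by positivity), min_le_left _ _, min_le_right _ _⟩
  have key : ∀ u ∈ sobolevBallLp s B,
      ∫⁻ ω, ‖ft u ω * φs (-ω)‖ₑ ≤ ENNReal.ofReal t⁻¹ * (m + m) := fun u hu => by
    obtain ⟨v, hv⟩ : ∃ v : Lp ℝ 1 (volume : Measure ℝ), v = (1 - t) • f₀ + t • u := ⟨_, rfl⟩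
    have hvS : v ∈ sobolevBallLp s B :=
      hv ▸ convex_sobolevBallLp s B hf₀ hu (by linarith) ht.le (by ring)
    have hvd : dist v f₀ < r := by
      have e : v - f₀ = t • (u - f₀) := by
        rw [hv, smul_sub, sub_smul, one_smul]; abel
      rw [dist_eq_norm, e, norm_smul, Real.norm_of_nonneg ht.le]
      have h3 := norm_sub_le u f₀
      rw [norm_eq_one_of_mem_sobolevBallLp hu, norm_eq_one_of_mem_sobolevBallLp hf₀] at h3
      nlinarith
    have hpv := hball v hvS hvd
    calc ∫⁻ ω, ‖ft u ω * φs (-ω)‖ₑ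
        ≤ ∫⁻ ω, ENNReal.ofReal t⁻¹ * (‖ft v ω * φs (-ω)‖ₑ + ‖ft f₀ ω * φs (-ω)‖ₑ) :=
          lintegral_mono fun ω => by
            rw [hv]; exact enorm_ft_mul_le_of_convex_comb u f₀ ht ht1 ω _
      _ = ENNReal.ofReal t⁻¹ *
          ((∫⁻ ω, ‖ft v ω * φs (-ω)‖ₑ) + ∫⁻ ω, ‖ft f₀ ω * φs (-ω)‖ₑ) := by
          rw [lintegral_const_mul' _ _ ENNReal.ofReal_ne_top, lintegral_add_left (hmeas v)]
      _ ≤ ENNReal.ofReal t⁻¹ * (m + m) := by gcongr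
  refine ⟨t⁻¹ * (m + m), by positivity, fun f hf => ?_⟩
  have h1 := key _ (toL1_mem_sobolevBallLp hf)
  simp only [ft_congr_ae hf.1.integrable.coeFn_toL1] at h1
  rw [integral_norm_eq_lintegral_enorm (hint f hf).1]
  refine ENNReal.toReal_le_of_le_ofReal (by positivity) (h1.trans (le_of_eq ?_))
  rw [ENNReal.ofReal_mul (by positivity), ENNReal.ofReal_add (by positivity) (by positivity),
    ENNReal.ofReal_natCast]

/-! ### From the Fourier bounds to one-sided variance and bias integrals -/

theorem measurable_cutoffRatio {g : ℝ → ℝ} (hg : IsPdf g) {φs : ℝ → ℂ} (hφ : Measurable φs)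
    (h : ℝ) : Measurable (cutoffRatio g φs h) := by
  unfold cutoffRatio
  have := hg.continuous_ft.measurable
  exact Measurable.ite (measurableSet_le (by fun_prop) measurable_const) (by fun_prop)
    measurable_const

theorem sq_norm_le_of_norm_le {z : ℂ} {C p P x ω : ℝ}
    (hz : ‖z‖ ≤ C * (ω ^ 2 + 1) ^ (-p / 2) * Real.exp (-P * |ω| ^ x)) :
    ‖z‖ ^ 2 ≤ C ^ 2 * ((ω ^ 2 + 1) ^ (-p) * Real.exp (-2 * P * |ω| ^ x)) := by
  refine (pow_le_pow_left₀ (norm_nonneg z) hz 2).trans (le_of_eq ?_)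
  rw [mul_pow, mul_pow, ← Real.exp_nat_mul, ← Real.rpow_mul_natCast (by positivity), mul_assoc]
  congr 3 <;> push_cast <;> ring

theorem norm_cutoffRatio_sq_le {a b d α β γ Cg Cφ : ℝ} (hCg : 0 < Cg) {g : ℝ → ℝ}
    (hg_low : ∀ ω : ℝ,
      Cg * (ω ^ 2 + 1) ^ (-α / 2) * Real.exp (-γ * |ω| ^ β) ≤ ‖ft g ω‖)
    {φs : ℝ → ℂ} (hφ_up : ∀ ω : ℝ,
      ‖φs ω‖ ≤ Cφ * (ω ^ 2 + 1) ^ (-a / 2) * Real.exp (-d * |ω| ^ b)) (h ω : ℝ) :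
    ‖cutoffRatio g φs h ω‖ ^ 2 ≤ {t : ℝ | h * t ≤ 1}.indicator
      (fun t => (Cφ / Cg) ^ 2 * weight (α - a) (2 * γ) β (-2 * d) b t) |ω| := by
  simp only [cutoffRatio, Set.indicator, Set.mem_ofPred_eq]
  split_ifs
  swap
  · simp
  have h1 := sq_norm_le_of_norm_le (hφ_up (-ω))
  rw [neg_sq, abs_neg] at h1
  set lo := Cg * (ω ^ 2 + 1) ^ (-α / 2) * Real.exp (-γ * |ω| ^ β)
  have hlo : 0 < lo := by positivity
  have h2 : lo ^ 2 = Cg ^ 2 * ((ω ^ 2 + 1) ^ (-α) * Real.exp (-2 * γ * |ω| ^ β)) := by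
    simp only [lo]
    rw [mul_pow, mul_pow, ← Real.exp_nat_mul, ← Real.rpow_mul_natCast (by positivity), mul_assoc]
    congr 3 <;> push_cast <;> ring
  rw [norm_div, div_pow]
  calc ‖φs (-ω)‖ ^ 2 / ‖ft g ω‖ ^ 2
      ≤ Cφ ^ 2 * ((ω ^ 2 + 1) ^ (-a) * Real.exp (-2 * d * |ω| ^ b)) / lo ^ 2 := by
        gcongr
        exact hg_low ω
    _ = (Cφ / Cg) ^ 2 * weight (α - a) (2 * γ) β (-2 * d) b |ω| := by
        have hpos : 0 < ω ^ 2 + 1 := by positivity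
        have e1 : (ω ^ 2 + 1) ^ (-a) = (ω ^ 2 + 1) ^ (α - a) * (ω ^ 2 + 1) ^ (-α) := by
          rw [← Real.rpow_add hpos]; ring_nf
        have e2 : Real.exp (-2 * d * |ω| ^ b) =
            Real.exp (2 * γ * |ω| ^ β + -2 * d * |ω| ^ b) * Real.exp (-2 * γ * |ω| ^ β) := by
          rw [← Real.exp_add]; ring_nf
        have : (ω ^ 2 + 1) ^ (-α) ≠ 0 := by positivity
        rw [h2, weight, sq_abs, e1, e2]
        field_simp

theorem memLp_cutoffRatio {a b d α β γ Cg Cφ : ℝ} (hCg : 0 < Cg) {g : ℝ → ℝ} (hg : IsPdf g)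
    (hg_low : ∀ ω : ℝ,
      Cg * (ω ^ 2 + 1) ^ (-α / 2) * Real.exp (-γ * |ω| ^ β) ≤ ‖ft g ω‖)
    {φs : ℝ → ℂ} (hφ : Measurable φs) (hφ_up : ∀ ω : ℝ,
      ‖φs ω‖ ≤ Cφ * (ω ^ 2 + 1) ^ (-a / 2) * Real.exp (-d * |ω| ^ b)) {h I : ℝ} (hI : 0 ≤ I)
    (hint : ∫⁻ t in Set.Ioi 0 ∩ {t : ℝ | h * t ≤ 1},
      ENNReal.ofReal (weight (α - a) (2 * γ) β (-2 * d) b t) ≤ ENNReal.ofReal I) :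
    MemLp (cutoffRatio g φs h) 2 ∧
      ∫ ω, ‖cutoffRatio g φs h ω‖ ^ 2 ≤ 2 * (Cφ / Cg) ^ 2 * I := by
  set W := weight (α - a) (2 * γ) β (-2 * d) b
  have hW : Measurable W := measurable_weight _ _ _ _ _
  have hS : MeasurableSet {t : ℝ | h * t ≤ 1} := measurableSet_le (by fun_prop) measurable_const
  have hm := measurable_cutoffRatio hg hφ h
  have key : ∫⁻ ω, ENNReal.ofReal (‖cutoffRatio g φs h ω‖ ^ 2) ≤
      ENNReal.ofReal (2 * (Cφ / Cg) ^ 2 * I) := by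
    calc ∫⁻ ω, ENNReal.ofReal (‖cutoffRatio g φs h ω‖ ^ 2)
        ≤ ∫⁻ ω, {t : ℝ | h * t ≤ 1}.indicator
            (fun t => ENNReal.ofReal ((Cφ / Cg) ^ 2) * ENNReal.ofReal (W t)) |ω| := by
          refine lintegral_mono fun ω => ?_
          refine (ENNReal.ofReal_le_ofReal
            (norm_cutoffRatio_sq_le hCg hg_low hφ_up h ω)).trans (le_of_eq ?_)
          simp only [Set.indicator]
          split_ifs
          · rw [ENNReal.ofReal_mul (by positivity)]
          · simp
      _ = 2 * (ENNReal.ofReal ((Cφ / Cg) ^ 2) * ∫⁻ t in Set.Ioi 0 ∩ {t : ℝ | h * t ≤ 1},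
            ENNReal.ofReal (W t)) := by
          rw [lintegral_comp_abs ((by fun_prop : Measurable fun t =>
            ENNReal.ofReal ((Cφ / Cg) ^ 2) * ENNReal.ofReal (W t)).indicator hS),
            lintegral_indicator hS, Measure.restrict_restrict hS, Set.inter_comm,
            lintegral_const_mul _ (by fun_prop)]
      _ ≤ 2 * (ENNReal.ofReal ((Cφ / Cg) ^ 2) * ENNReal.ofReal I) := by gcongr
      _ = ENNReal.ofReal (2 * (Cφ / Cg) ^ 2 * I) := by
          rw [mul_assoc, ENNReal.ofReal_mul (by norm_num), ENNReal.ofReal_mul (by positivity)]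
          norm_num
  have hint2 : Integrable fun ω => ‖cutoffRatio g φs h ω‖ ^ 2 := by
    refine ⟨by fun_prop, ?_⟩
    rw [hasFiniteIntegral_iff_ofReal (Eventually.of_forall fun ω => by positivity)]
    exact key.trans_lt ENNReal.ofReal_lt_top
  refine ⟨(memLp_two_iff_integrable_sq_norm hm.aestronglyMeasurable).2 hint2, ?_⟩
  rwa [← ENNReal.ofReal_le_ofReal_iff (by positivity),
    ofReal_integral_eq_lintegral_ofReal hint2 (Eventually.of_forall fun ω => by positivity)]

/-- Cauchy-Schwarz after inserting `(ω² + 1)^(s/2) (ω² + 1)^(-s/2)`: one factor is at most `B` by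
membership in the class, the other is a tail of `|φ*|² (ω² + 1)^(-s)`. -/
theorem setIntegral_norm_ft_mul_le {s B a b d Cφ : ℝ} (hB : 0 < B) (hCφ : 0 ≤ Cφ)
    {φs : ℝ → ℂ} (hφ : Measurable φs) (hφ_up : ∀ ω : ℝ,
      ‖φs ω‖ ≤ Cφ * (ω ^ 2 + 1) ^ (-a / 2) * Real.exp (-d * |ω| ^ b)) {h J : ℝ} (hJ : 0 ≤ J)
    (hint : ∫⁻ t in Set.Ioi 0 ∩ {t : ℝ | 1 < h * t},
      ENNReal.ofReal (weight (-(s + a)) (-2 * d) b 0 0 t) ≤ ENNReal.ofReal J)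
    {f : ℝ → ℝ} (hf : f ∈ sobolevBall s B) :
    ∫ ω in {ω : ℝ | 1 < h * |ω|}, ‖ft f ω * φs (-ω)‖ ≤ B * (Cφ * √(2 * J)) := by
  have hft := hf.1.continuous_ft.measurable
  set W := weight (-(s + a)) (-2 * d) b 0 0
  have hW : Measurable W := measurable_weight _ _ _ _ _
  have hS : MeasurableSet {t : ℝ | 1 < h * t} := measurableSet_lt measurable_const (by fun_prop)
  set S := {ω : ℝ | 1 < h * |ω|}
  set u : ℝ → ℝ≥0∞ := fun ω => ENNReal.ofReal (‖ft f ω‖ * (ω ^ 2 + 1) ^ (s / 2))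
  set v : ℝ → ℝ≥0∞ := fun ω => ENNReal.ofReal (‖φs (-ω)‖ * (ω ^ 2 + 1) ^ (-s / 2))
  have hu : Measurable u := by fun_prop
  have hv : Measurable v := by fun_prop
  have hu2 : ∫⁻ ω in S, u ω ^ (2 : ℝ) ≤ ENNReal.ofReal (B ^ 2) := by
    refine (setLIntegral_le_lintegral _ _).trans ((le_of_eq ?_).trans hf.2)
    refine lintegral_congr fun ω => ?_
    rw [ENNReal.ofReal_rpow_of_nonneg (by positivity) (by norm_num)]
    congr 1
    rw [Real.rpow_two, mul_pow, ← Real.rpow_mul_natCast (by positivity)]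
    congr 2; push_cast; ring
  have hv2 : ∫⁻ ω in S, v ω ^ (2 : ℝ) ≤ ENNReal.ofReal (Cφ ^ 2 * (2 * J)) := by
    calc ∫⁻ ω in S, v ω ^ (2 : ℝ)
        ≤ ∫⁻ ω in S, ENNReal.ofReal (Cφ ^ 2) * ENNReal.ofReal (W |ω|) := by
          refine lintegral_mono fun ω => ?_
          simp only [v]
          rw [← ENNReal.ofReal_mul (by positivity),
            ENNReal.ofReal_rpow_of_nonneg (by positivity) (by norm_num)]
          apply ENNReal.ofReal_le_ofReal
          rw [Real.rpow_two, mul_pow, ← Real.rpow_mul_natCast (by positivity)]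
          have h1 := sq_norm_le_of_norm_le (hφ_up (-ω))
          rw [neg_sq, abs_neg] at h1
          have hpos : 0 < ω ^ 2 + 1 := by positivity
          calc _ ≤ Cφ ^ 2 * ((ω ^ 2 + 1) ^ (-a) * Real.exp (-2 * d * |ω| ^ b)) *
                (ω ^ 2 + 1) ^ (-s / 2 * (2 : ℕ)) := by gcongr
            _ = Cφ ^ 2 * W |ω| := by
              simp only [W, weight, sq_abs]
              have e : (ω ^ 2 + 1) ^ (-(s + a)) = (ω ^ 2 + 1) ^ (-a) *
                  (ω ^ 2 + 1) ^ (-s / 2 * (2 : ℕ)) := by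
                rw [← Real.rpow_add hpos]; congr 1; push_cast; ring
              rw [e, zero_mul, add_zero]; ring
      _ = ENNReal.ofReal (Cφ ^ 2) * (2 * ∫⁻ t in Set.Ioi 0 ∩ {t : ℝ | 1 < h * t},
            ENNReal.ofReal (W t)) := by
          rw [lintegral_const_mul _ (by fun_prop)]
          congr 1
          exact setLIntegral_comp_abs (v := fun t => ENNReal.ofReal (W t)) (by fun_prop) hS
      _ ≤ ENNReal.ofReal (Cφ ^ 2) * (2 * ENNReal.ofReal J) := by gcongr
      _ = ENNReal.ofReal (Cφ ^ 2 * (2 * J)) := by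
          rw [ENNReal.ofReal_mul (by positivity), ENNReal.ofReal_mul (by norm_num)]
          norm_num
  rw [integral_norm_eq_lintegral_enorm (by fun_prop)]
  refine ENNReal.toReal_le_of_le_ofReal (by positivity) ?_
  calc ∫⁻ ω in S, ‖ft f ω * φs (-ω)‖ₑ = ∫⁻ ω in S, (u * v) ω := by
        refine lintegral_congr fun ω => ?_
        simp only [u, v, Pi.mul_apply]
        rw [← ENNReal.ofReal_mul (by positivity), ← ofReal_norm, norm_mul]
        congr 1
        have hpos : 0 < ω ^ 2 + 1 := by positivity
        have e : (ω ^ 2 + 1) ^ (s / 2) * (ω ^ 2 + 1) ^ (-s / 2) = 1 := by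
          rw [← Real.rpow_add hpos, neg_div, add_neg_cancel, Real.rpow_zero]
        linear_combination (-(‖ft f ω‖ * ‖φs (-ω)‖)) * e
    _ ≤ (∫⁻ ω in S, u ω ^ (2 : ℝ)) ^ (1 / (2 : ℝ)) * (∫⁻ ω in S, v ω ^ (2 : ℝ)) ^ (1 / (2 : ℝ)) :=
        ENNReal.lintegral_mul_le_Lp_mul_Lq _ Real.HolderConjugate.two_two hu.aemeasurable
          hv.aemeasurable
    _ ≤ ENNReal.ofReal (B ^ 2) ^ (1 / (2 : ℝ)) *
        ENNReal.ofReal (Cφ ^ 2 * (2 * J)) ^ (1 / (2 : ℝ)) := by gcongr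
    _ = ENNReal.ofReal (B * (Cφ * √(2 * J))) := by
        rw [ENNReal.ofReal_rpow_of_nonneg (by positivity) (by norm_num),
          ENNReal.ofReal_rpow_of_nonneg (by positivity) (by norm_num),
          ← ENNReal.ofReal_mul (by positivity), ← Real.sqrt_eq_rpow, ← Real.sqrt_eq_rpow,
          Real.sqrt_sq hB.le, Real.sqrt_mul (by positivity), Real.sqrt_sq hCφ]

/-- The worst-case risk is bounded by a one-sided variance integral and a one-sided bias integral.
The bias is also bounded uniformly in the bandwidth, so that the bias integral is not needed if
the rate does not tend to zero. -/
theorem exists_worstRisk_le {s B a b d α β γ Cg Cφ : ℝ} (hB : 0 < B) (hCg : 0 < Cg)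
    (hCφ : 0 ≤ Cφ) {g : ℝ → ℝ} (hg : IsPdf g) (hg_bdd : BddAbove (Set.range g))
    (hg_low : ∀ ω : ℝ,
      Cg * (ω ^ 2 + 1) ^ (-α / 2) * Real.exp (-γ * |ω| ^ β) ≤ ‖ft g ω‖)
    {φs : ℝ → ℂ} (hφ : Measurable φs) (hφ_up : ∀ ω : ℝ,
      ‖φs ω‖ ≤ Cφ * (ω ^ 2 + 1) ^ (-a / 2) * Real.exp (-d * |ω| ^ b))
    {Φ : (ℝ → ℝ) → ℂ} (hΦ : IsRepresentedOn (sobolevBall s B) Φ φs) :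
    ∃ K : ℝ, 0 < K ∧ ∀ (n : ℕ) (h I J : ℝ), 0 < n → 0 ≤ I → 0 ≤ J →
      ∫⁻ t in Set.Ioi 0 ∩ {t : ℝ | h * t ≤ 1},
        ENNReal.ofReal (weight (α - a) (2 * γ) β (-2 * d) b t) ≤ ENNReal.ofReal I →
      (∫⁻ t in Set.Ioi 0 ∩ {t : ℝ | 1 < h * t},
        ENNReal.ofReal (weight (-(s + a)) (-2 * d) b 0 0 t) ≤ ENNReal.ofReal J ∨ 1 ≤ J) →
      worstRisk (sobolevBall s B) g Φ φs n h ≤ ENNReal.ofReal (K * ((n : ℝ)⁻¹ * I + J)) := by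
  obtain ⟨M, hM⟩ := hg_bdd
  have hM' : ∀ x, g x ≤ M := fun x => hM ⟨x, rfl⟩
  have hM0 : 0 ≤ M := (hg.nonneg 0).trans (hM' 0)
  have hg0 : ∀ ω, ft g ω ≠ 0 := fun ω h0 => by
    have := hg_low ω
    rw [h0, norm_zero] at this
    have h2 : 0 < Cg * (ω ^ 2 + 1) ^ (-α / 2) * Real.exp (-γ * |ω| ^ β) := by positivity
    linarith
  obtain ⟨K₀, hK₀, hbound⟩ := exists_bound_integral_norm_ft_mul hφ fun f hf => (hΦ f hf).1
  -- `K₁` carries the variance, `K₂` the bias by Cauchy-Schwarz, and `K₃` the uniform bias bound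
  -- used when `1 ≤ J`. The extra 1 below keeps the constant positive even if `Cφ = 0`.
  set K₁ := M * ((2 * Real.pi)⁻¹ * (2 * (Cφ / Cg) ^ 2))
  set K₂ := ((2 * Real.pi)⁻¹) ^ 2 * (B ^ 2 * Cφ ^ 2 * 2)
  set K₃ := ((2 * Real.pi)⁻¹ * K₀) ^ 2
  refine ⟨K₁ + K₂ + K₃ + 1, by positivity, fun n h I J hn hI hJ hV hbias => ?_⟩
  obtain ⟨hr, hrI⟩ := memLp_cutoffRatio hCg hg hg_low hφ hφ_up hI hV
  have hvar : (n : ℝ)⁻¹ * (M * ((2 * Real.pi)⁻¹ * ∫ ω, ‖cutoffRatio g φs h ω‖ ^ 2)) ≤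
      K₁ * ((n : ℝ)⁻¹ * I) := by
    calc _ ≤ (n : ℝ)⁻¹ * (M * ((2 * Real.pi)⁻¹ * (2 * (Cφ / Cg) ^ 2 * I))) := by gcongr
      _ = _ := by simp only [K₁]; ring
  have hnI : 0 ≤ (n : ℝ)⁻¹ * I := by positivity
  have hK₁ : 0 ≤ K₁ := by positivity
  have hK₂ : 0 ≤ K₂ := by positivity
  have hK₃ : 0 ≤ K₃ := by positivity
  have hsob : ∀ f ∈ sobolevBall s B, IsPdf f := fun f hf => hf.1
  rcases hbias with hb | hJ1
  · refine (worstRisk_le hsob hg hM' hg0 hΦ hr (β := B * (Cφ * √(2 * J)))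
      (fun f hf => setIntegral_norm_ft_mul_le hB hCφ hφ hφ_up hJ hb hf) hn).trans
      (ENNReal.ofReal_le_ofReal ?_)
    have e : ((2 * Real.pi)⁻¹ * (B * (Cφ * √(2 * J)))) ^ 2 = K₂ * J := by
      simp only [K₂, mul_pow, Real.sq_sqrt (by positivity : 0 ≤ 2 * J)]; ring
    rw [e]
    nlinarith [mul_nonneg hK₁ hJ, mul_nonneg hK₂ hnI, mul_nonneg hK₃ hnI, mul_nonneg hK₃ hJ]
  · refine (worstRisk_le hsob hg hM' hg0 hΦ hr (β := K₀) (fun f hf => ?_) hn).trans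
      (ENNReal.ofReal_le_ofReal ?_)
    · exact (setIntegral_le_integral (hΦ f hf).1.norm
        (Eventually.of_forall fun ω => norm_nonneg _)).trans (hbound f hf)
    · change _ + K₃ ≤ _
      have : K₃ ≤ K₃ * J := le_mul_of_one_le_right hK₃ hJ1
      nlinarith [mul_nonneg hK₁ hJ, mul_nonneg hK₂ hnI, mul_nonneg hK₃ hnI, mul_nonneg hK₂ hJ]

/-! ### Limits of the growth factor and the borderline logarithm -/

theorem tendsto_growthFactor (p P Q : ℝ) {x y : ℝ} (hx : 0 < x) (hy : y < x) :
    Tendsto (growthFactor p P x Q y) atTop (𝓝 (P * x)) := by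
  have h1 := (tendsto_rpow_neg_atTop hx).const_mul (2 * p + 1 - x)
  have h2 := (tendsto_rpow_neg_atTop (sub_pos.2 hy)).const_mul (Q * y)
  have h3 := (h1.add_const (P * x)).add h2
  simp only [mul_zero, zero_add, add_zero, neg_sub] at h3
  exact h3

/-- Without an exponential factor the sign of `2p + 1` decides. For the variance `p = A₂`, whence
the threshold `A₂ = -1/2`. -/
theorem tendsto_growthFactor_zero (p : ℝ) :
    Tendsto (growthFactor p 0 0 0 0) atTop (𝓝 (2 * p + 1)) := by
  have : growthFactor p 0 0 0 0 = fun _ => 2 * p + 1 := by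
    ext t; simp [growthFactor]
  rw [this]
  exact tendsto_const_nhds

theorem weight_comm (p P x Q y : ℝ) : weight p P x Q y = weight p Q y P x := by
  ext t; simp only [weight, add_comm]

theorem weight_same_exponent (p P Q x : ℝ) : weight p P x Q x = weight p (P + Q) x 0 0 := by
  ext t; simp only [weight]; ring_nf

theorem weight_zero_coeff (p x : ℝ) : weight p 0 x 0 0 = weight p 0 0 0 0 := by
  ext t; simp [weight]

theorem primitiveWeight_zero (p t : ℝ) : primitiveWeight p 0 0 0 0 t = t ^ (2 * p + 1) := by
  simp [primitiveWeight]

theorem exists_setLIntegral_Ioi_zero_weight_le (p P Q : ℝ) {x y κ : ℝ} (hx : 0 ≤ x) (hy : 0 ≤ y)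
    (hκ : κ < 0) (hk : Tendsto (growthFactor p P x Q y) atTop (𝓝 κ)) :
    ∃ C : ℝ, 0 ≤ C ∧ ∫⁻ t in Set.Ioi 0, ENNReal.ofReal (weight p P x Q y t) ≤
      ENNReal.ofReal C := by
  obtain ⟨C₁, t₀, hC₁, ht₀, h₁⟩ := exists_setLIntegral_Ioi_weight_le p P Q hκ hk
  obtain ⟨C₂, hC₂, h₂⟩ := exists_setLIntegral_Ioc_weight_le p P Q hx hy t₀
  have hF := (primitiveWeight_pos p P x Q y (by linarith : 0 < t₀)).le
  refine ⟨C₂ + C₁ * primitiveWeight p P x Q y t₀, by positivity, ?_⟩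
  rw [← Set.Ioc_union_Ioi_eq_Ioi (by linarith : 0 ≤ t₀), ENNReal.ofReal_add hC₂ (by positivity)]
  exact (lintegral_union_le _ _ _).trans (add_le_add h₂ (h₁ t₀ le_rfl))

/-- In the borderline case the weight is at most `1/t`, with primitive `log`. Taking `T ≥ e` gives
`log T ≥ 1`, which absorbs the integral over `(0, 1]`. -/
theorem exists_setLIntegral_Ioc_weight_le_log :
    ∃ C : ℝ, 0 < C ∧ ∀ T, Real.exp 1 ≤ T →
      ∫⁻ t in Set.Ioc 0 T, ENNReal.ofReal (weight (-1 / 2) 0 0 0 0 t) ≤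
        ENNReal.ofReal (C * Real.log T) := by
  obtain ⟨C₀, hC₀, h₀⟩ := exists_setLIntegral_Ioc_weight_le (-1 / 2) 0 0 le_rfl le_rfl 1
  refine ⟨C₀ + 1, by positivity, fun T hT => ?_⟩
  have hT1 : 1 ≤ T := le_trans (Real.one_le_exp (by norm_num)) hT
  have hlog : 1 ≤ Real.log T := (Real.le_log_iff_exp_le (by linarith)).2 hT
  have h := setLIntegral_Ioc_le_of_hasDerivAt (F := Real.log) (F' := fun t => t⁻¹)
    (u := weight (-1 / 2) 0 0 0 0) (c := 1) hT1 one_pos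
    (fun t ht => Real.hasDerivAt_log (by linarith)) (fun t _ => weight_nonneg _ _ _ _ _ t)
    (fun t ht => ?_)
  · rw [← Set.Ioc_union_Ioc_eq_Ioc zero_le_one hT1]
    refine (lintegral_union_le _ _ _).trans ((add_le_add h₀ h).trans ?_)
    rw [Real.log_one, sub_zero, div_one, ← ENNReal.ofReal_add hC₀ (by linarith)]
    apply ENNReal.ofReal_le_ofReal
    nlinarith
  · have ht0 : 0 < t := by linarith
    have e : t⁻¹ = (t ^ 2) ^ (-1 / 2 : ℝ) := by
      rw [← Real.rpow_natCast, ← Real.rpow_mul ht0.le, ← Real.rpow_neg_one]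
      norm_num
    simp only [weight, one_mul, zero_mul, add_zero, Real.exp_zero, mul_one]
    rw [e]
    exact Real.rpow_le_rpow_of_nonpos (by positivity) (by linarith) (by norm_num)

/-! ### Rate bounds without cut-off, and general criteria -/

/-- The one-sided variance integral of the cut-off estimator. -/
noncomputable def varianceIntegral (a b d α β γ h : ℝ) : ℝ≥0∞ :=
  ∫⁻ t in Set.Ioi 0 ∩ {t : ℝ | h * t ≤ 1},
    ENNReal.ofReal (weight (α - a) (2 * γ) β (-2 * d) b t)

/-- The one-sided squared bias integral of the cut-off estimator. -/
noncomputable def biasIntegral (s a b d h : ℝ) : ℝ≥0∞ :=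
  ∫⁻ t in Set.Ioi 0 ∩ {t : ℝ | 1 < h * t},
    ENNReal.ofReal (weight (-(s + a)) (-2 * d) b 0 0 t)

/-- The variance and bias integrals for the bandwidths `h` are compatible with the rate `Δ`. -/
def RateBound (s a b d α β γ : ℝ) (h Δ : ℕ → ℝ) : Prop :=
  ∃ C : ℝ, 0 ≤ C ∧ ∀ᶠ n : ℕ in atTop, 0 ≤ Δ n ∧
    varianceIntegral a b d α β γ (h n) ≤ ENNReal.ofReal (C * (n * Δ n)) ∧
    (biasIntegral s a b d (h n) ≤ ENNReal.ofReal (C * Δ n) ∨ 1 ≤ C * Δ n)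

theorem varianceIntegral_zero (a b d α β γ : ℝ) : varianceIntegral a b d α β γ 0 =
    ∫⁻ t in Set.Ioi 0, ENNReal.ofReal (weight (α - a) (2 * γ) β (-2 * d) b t) := by
  simp [varianceIntegral]

theorem biasIntegral_zero (s a b d : ℝ) : biasIntegral s a b d 0 = 0 := by
  have : {t : ℝ | (1 : ℝ) < 0 * t} = ∅ := by ext t; simp
  rw [biasIntegral, this]; simp

theorem varianceIntegral_of_pos (a b d α β γ : ℝ) {h : ℝ} (hh : 0 < h) :
    varianceIntegral a b d α β γ h =
      ∫⁻ t in Set.Ioc 0 h⁻¹, ENNReal.ofReal (weight (α - a) (2 * γ) β (-2 * d) b t) := by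
  have : Set.Ioi 0 ∩ {t : ℝ | h * t ≤ 1} = Set.Ioc 0 h⁻¹ := by
    ext t
    simp only [Set.mem_inter_iff, Set.mem_Ioi, Set.mem_ofPred_eq, Set.mem_Ioc]
    rw [← one_div, le_div_iff₀' hh]
  rw [varianceIntegral, this]

theorem biasIntegral_of_pos (s a b d : ℝ) {h : ℝ} (hh : 0 < h) :
    biasIntegral s a b d h =
      ∫⁻ t in Set.Ioi h⁻¹, ENNReal.ofReal (weight (-(s + a)) (-2 * d) b 0 0 t) := by
  have : Set.Ioi 0 ∩ {t : ℝ | 1 < h * t} = Set.Ioi h⁻¹ := by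
    ext t
    simp only [Set.mem_inter_iff, Set.mem_Ioi, Set.mem_ofPred_eq, inv_lt_iff_one_lt_mul₀' hh]
    refine ⟨fun h => h.2, fun h1 => ⟨?_, h1⟩⟩
    by_contra hneg
    nlinarith
  rw [biasIntegral, this]

/-- Without cut-off there is no bias, so a convergent variance integral already gives the parametric
rate. -/
theorem rateBound_zero_of_le {s a b d α β γ C : ℝ} (hC : 0 ≤ C)
    (h : ∫⁻ t in Set.Ioi 0, ENNReal.ofReal (weight (α - a) (2 * γ) β (-2 * d) b t) ≤
      ENNReal.ofReal C) :
    RateBound s a b d α β γ (fun _ => 0) fun n => (n : ℝ)⁻¹ := by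
  refine ⟨C, hC, ?_⟩
  filter_upwards [eventually_gt_atTop 0] with n hn
  have hn' : (n : ℝ) ≠ 0 := by positivity
  refine ⟨by positivity, ?_, Or.inl ?_⟩
  · rw [varianceIntegral_zero, mul_inv_cancel₀ hn', mul_one]
    exact h
  · rw [biasIntegral_zero]; exact zero_le

theorem rateBound_of_lt (s a b d α β γ : ℝ) (hβ : 0 ≤ β) (hb : β < b) (hd : 0 < d) :
    RateBound s a b d α β γ (fun _ => 0) fun n => (n : ℝ)⁻¹ := by
  have hb0 : 0 < b := by linarith
  -- The larger exponent `b` must take the leading slot of the weight; hence the swap by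
  -- `weight_comm`.
  obtain ⟨C, hC, h⟩ := exists_setLIntegral_Ioi_zero_weight_le (α - a) (-2 * d) (2 * γ) hb0.le hβ
    (by nlinarith) (tendsto_growthFactor (α - a) (-2 * d) (2 * γ) hb0 hb)
  rw [weight_comm] at h
  exact rateBound_zero_of_le hC h

theorem rateBound_of_eq_of_lt (s a d α β γ : ℝ) (hβ : 0 < β) (hd : γ < d) :
    RateBound s a β d α β γ (fun _ => 0) fun n => (n : ℝ)⁻¹ := by
  obtain ⟨C, hC, h⟩ := exists_setLIntegral_Ioi_zero_weight_le (α - a) (2 * γ + -2 * d) 0 hβ.le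
    le_rfl (by nlinarith) (tendsto_growthFactor (α - a) (2 * γ + -2 * d) 0 hβ hβ)
  rw [← weight_same_exponent] at h
  exact rateBound_zero_of_le hC h

theorem weight_cancel (p γ β : ℝ) : weight p (2 * γ) β (-2 * γ) β = weight p 0 0 0 0 := by
  rw [weight_same_exponent, show 2 * γ + -2 * γ = 0 by ring, weight_zero_coeff]

theorem rateBound_of_eq_of_eq (s a α β γ : ℝ) (hA : α - a < -1 / 2) :
    RateBound s a β γ α β γ (fun _ => 0) fun n => (n : ℝ)⁻¹ := by
  obtain ⟨C, hC, h⟩ := exists_setLIntegral_Ioi_zero_weight_le (α - a) 0 0 le_rfl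
    le_rfl (by linarith) (tendsto_growthFactor_zero (α - a))
  rw [← weight_cancel _ γ β] at h
  exact rateBound_zero_of_le hC h

/-- Variance and bias bounds along cut-off points tending to infinity. -/
theorem rateBound_of_tendsto {s a b d α β γ : ℝ} {h Δ : ℕ → ℝ} {T : ℕ → ℝ}
    (hT : Tendsto T atTop atTop) (hTh : ∀ᶠ n in atTop, h n = (T n)⁻¹)
    (hΔ : ∀ᶠ n in atTop, 0 ≤ Δ n) {V W : ℝ → ℝ} {t₀ : ℝ}
    (hV : ∀ t, t₀ ≤ t → ∫⁻ t in Set.Ioc 0 t,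
      ENNReal.ofReal (weight (α - a) (2 * γ) β (-2 * d) b t) ≤ ENNReal.ofReal (V t))
    (hW : ∀ t, t₀ ≤ t → ∫⁻ t in Set.Ioi t,
      ENNReal.ofReal (weight (-(s + a)) (-2 * d) b 0 0 t) ≤ ENNReal.ofReal (W t))
    {C₁ C₂ : ℝ} (hVT : ∀ᶠ n : ℕ in atTop, V (T n) ≤ C₁ * (n * Δ n))
    (hWT : (∀ᶠ n in atTop, W (T n) ≤ C₂ * Δ n)) :
    RateBound s a b d α β γ h Δ := by
  refine ⟨max 0 (max C₁ C₂), le_max_left _ _, ?_⟩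
  filter_upwards [hTh, hΔ, hVT, hWT, hT.eventually_ge_atTop t₀, hT.eventually_gt_atTop 0]
    with n h1 h2 h3 h4 h5 h6
  have hpos : 0 < h n := by rw [h1]; positivity
  have hinv : (h n)⁻¹ = T n := by rw [h1, inv_inv]
  refine ⟨h2, ?_, Or.inl ?_⟩
  · rw [varianceIntegral_of_pos _ _ _ _ _ _ hpos, hinv]
    refine (hV _ h5).trans (ENNReal.ofReal_le_ofReal (h3.trans ?_))
    gcongr
    exact (le_max_left _ _).trans (le_max_right _ _)
  · rw [biasIntegral_of_pos _ _ _ _ hpos, hinv]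
    refine (hW _ h5).trans (ENNReal.ofReal_le_ofReal (h4.trans ?_))
    gcongr
    exact (le_max_right _ _).trans (le_max_right _ _)

/-- Variance bounds suffice if the rate is bounded below. -/
theorem rateBound_of_tendsto_of_one_le {s a b d α β γ : ℝ} {h Δ : ℕ → ℝ} {T : ℕ → ℝ}
    (hT : Tendsto T atTop atTop) (hTh : ∀ᶠ n in atTop, h n = (T n)⁻¹)
    (hΔ : ∀ᶠ n in atTop, 1 ≤ Δ n) {V : ℝ → ℝ} {t₀ : ℝ}
    (hV : ∀ t, t₀ ≤ t → ∫⁻ t in Set.Ioc 0 t,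
      ENNReal.ofReal (weight (α - a) (2 * γ) β (-2 * d) b t) ≤ ENNReal.ofReal (V t))
    {C₁ : ℝ} (hVT : ∀ᶠ n : ℕ in atTop, V (T n) ≤ C₁ * (n * Δ n)) :
    RateBound s a b d α β γ h Δ := by
  refine ⟨max 1 C₁, by positivity, ?_⟩
  filter_upwards [hTh, hΔ, hVT, hT.eventually_ge_atTop t₀, hT.eventually_gt_atTop 0]
    with n h1 h2 h3 h5 h6
  have hpos : 0 < h n := by rw [h1]; positivity
  have hinv : (h n)⁻¹ = T n := by rw [h1, inv_inv]
  have hΔ0 : 0 ≤ Δ n := by linarith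
  refine ⟨hΔ0, ?_, Or.inr ?_⟩
  · rw [varianceIntegral_of_pos _ _ _ _ _ _ hpos, hinv]
    refine (hV _ h5).trans (ENNReal.ofReal_le_ofReal (h3.trans ?_))
    gcongr
    exact le_max_right _ _
  · exact one_le_mul_of_one_le_of_one_le (le_max_left _ _) h2

theorem tendsto_log_natCast : Tendsto (fun n : ℕ => Real.log n) atTop atTop :=
  Real.tendsto_log_atTop.comp tendsto_natCast_atTop_atTop

theorem tendsto_log_log_natCast : Tendsto (fun n : ℕ => Real.log (Real.log n)) atTop atTop :=
  Real.tendsto_log_atTop.comp tendsto_log_natCast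

/-- The bias integral beyond `t`, for `b = d = 0` or for `b, d > 0`. -/
theorem exists_bias_bound {s a b d : ℝ}
    (h : (0 < b ∧ 0 < d) ∨ (b = 0 ∧ d = 0 ∧ 0 < s + a + (b - 1) / 2)) :
    ∃ C t₀ : ℝ, 0 < C ∧ 1 ≤ t₀ ∧ ∀ t, t₀ ≤ t →
      ∫⁻ t in Set.Ioi t, ENNReal.ofReal (weight (-(s + a)) (-2 * d) b 0 0 t) ≤
        ENNReal.ofReal (C * (t ^ (-(2 * (s + a + (b - 1) / 2))) * Real.exp (-2 * d * t ^ b))) := by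
  -- With `b, d > 0` the exponential forces decay; with `b = d = 0` the limit is `-2A₁`, and
  -- convergence rests on `A₁ > 0`.
  have key : ∃ κ < 0, Tendsto (growthFactor (-(s + a)) (-2 * d) b 0 0) atTop (𝓝 κ) := by
    rcases h with ⟨hb, hd⟩ | ⟨rfl, rfl, hA⟩
    · exact ⟨-2 * d * b, by nlinarith, tendsto_growthFactor _ _ _ hb hb⟩
    · exact ⟨2 * (-(s + a)) + 1, by linarith, by
        simpa using tendsto_growthFactor_zero (-(s + a))⟩
  obtain ⟨κ, hκ, hk⟩ := key
  obtain ⟨C, t₀, hC, ht₀, hB⟩ := exists_setLIntegral_Ioi_weight_le _ _ _ hκ hk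
  refine ⟨C, t₀, hC, ht₀, fun t ht => (hB t ht).trans (le_of_eq ?_)⟩
  rw [primitiveWeight, zero_mul, add_zero]
  congr 4; ring

/-! ### Equal exponential rates: `b = β`, `d = γ` -/

section LogBandwidth

variable {β γ : ℝ}

theorem tendsto_log_div_rpow (hβ : 0 < β) (hγ : 0 < γ) :
    Tendsto (fun n : ℕ => (Real.log n / (2 * γ)) ^ (1 / β)) atTop atTop :=
  (tendsto_rpow_atTop (by positivity)).comp (tendsto_log_natCast.atTop_div_const (by positivity))

theorem log_div_rpow_neg (hγ : 0 < γ) : ∀ᶠ n : ℕ in atTop,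
    (Real.log n / (2 * γ)) ^ (-1 / β) = ((Real.log n / (2 * γ)) ^ (1 / β))⁻¹ := by
  filter_upwards [tendsto_log_natCast.eventually_gt_atTop 0] with n hn
  rw [← Real.rpow_neg (by positivity), neg_div]

theorem exp_neg_mul_log_div_rpow (hβ : 0 < β) (hγ : 0 < γ) : ∀ᶠ n : ℕ in atTop,
    Real.exp (-2 * γ * ((Real.log n / (2 * γ)) ^ (1 / β)) ^ β) = (n : ℝ)⁻¹ := by
  filter_upwards [tendsto_log_natCast.eventually_gt_atTop 0, eventually_gt_atTop 0] with n hn hn0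
  rw [← Real.rpow_mul (by positivity), one_div_mul_cancel hβ.ne', Real.rpow_one,
    show -2 * γ * (Real.log n / (2 * γ)) = -Real.log n by field_simp, Real.exp_neg,
    Real.exp_log (by exact_mod_cast hn0)]

/-- The exponentials cancel in the variance integral, leaving `log T`, of order `log log n`. In the
bias `exp(-2γT^β) = 1/n`, and the power `T^(-2A₁)` is at most one because `A₁ = s + α + β/2 ≥ 0`. -/
theorem rateBound_log_critical {s a α : ℝ} (hs : 0 ≤ s) (hα : 0 ≤ α) (hβ : 0 < β) (hγ : 0 < γ)
    (hA : α - a = -1 / 2) :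
    RateBound s a β γ α β γ (fun n => (Real.log n / (2 * γ)) ^ (-1 / β))
      fun n => (n : ℝ)⁻¹ * Real.log (Real.log n) := by
  obtain ⟨C₁, hC₁, hV⟩ := exists_setLIntegral_Ioc_weight_le_log
  obtain ⟨C₂, t₀, hC₂, ht₀, hW⟩ := exists_bias_bound (s := s) (a := a) (Or.inl ⟨hβ, hγ⟩)
  refine rateBound_of_tendsto (t₀ := max t₀ (Real.exp 1)) (tendsto_log_div_rpow hβ hγ)
    (log_div_rpow_neg hγ) ?_ (fun t ht => ?_) (fun t ht => hW t ((le_max_left _ _).trans ht))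
    (V := fun t => C₁ * Real.log t)
    -- Here `log T = β⁻¹ (log log n - log 2γ)`, and the constant is absorbed once `log log n ≥ 1`.
    (C₁ := C₁ * (1 / β * (1 + |Real.log (2 * γ)|))) (C₂ := C₂) ?_ ?_
  · filter_upwards [tendsto_log_log_natCast.eventually_gt_atTop 0] with n hn
    positivity
  · rw [hA, weight_cancel]
    exact hV t ((le_max_right _ _).trans ht)
  · filter_upwards [tendsto_log_natCast.eventually_gt_atTop 0,
      tendsto_log_log_natCast.eventually_ge_atTop 1, eventually_gt_atTop 0] with n h1 h2 h3
    have hn : (n : ℝ) ≠ 0 := by positivity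
    rw [mul_inv_cancel_left₀ hn, Real.log_rpow (by positivity),
      Real.log_div h1.ne' (by positivity), mul_assoc, mul_assoc]
    gcongr
    have := neg_abs_le (Real.log (2 * γ))
    nlinarith [abs_nonneg (Real.log (2 * γ))]
  · filter_upwards [exp_neg_mul_log_div_rpow hβ hγ,
      tendsto_log_log_natCast.eventually_ge_atTop 1,
      (tendsto_log_div_rpow hβ hγ).eventually_ge_atTop 1] with n h1 h2 h3
    rw [h1, mul_comm (n : ℝ)⁻¹]
    gcongr
    refine (Real.rpow_le_one_of_one_le_of_nonpos h3 ?_).trans h2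
    linarith

/-- The variance integral is of order `T^(2A₂+1)`. The squared bias `T^(-2A₁)/n` is no larger than
`T^(2A₂+1)/n`, because `2A₁ + 2A₂ + 1 = 2s + 2α + β ≥ 0`. -/
theorem rateBound_log_supercritical {s a α : ℝ} (hs : 0 ≤ s) (hα : 0 ≤ α) (hβ : 0 < β)
    (hγ : 0 < γ) (hA : α - a > -1 / 2) :
    RateBound s a β γ α β γ (fun n => (Real.log n / (2 * γ)) ^ (-1 / β))
      fun n => (n : ℝ)⁻¹ * Real.log n ^ ((2 * (α - a) + 1) / β) := by
  obtain ⟨C₁, t₁, hC₁, ht₁, hV⟩ := exists_setLIntegral_Ioc_weight_le_primitiveWeight (α - a) 0 0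
    le_rfl le_rfl (by linarith) (tendsto_growthFactor_zero (α - a))
  obtain ⟨C₂, t₀, hC₂, ht₀, hW⟩ := exists_bias_bound (s := s) (a := a) (Or.inl ⟨hβ, hγ⟩)
  set T := fun n : ℕ => (Real.log n / (2 * γ)) ^ (1 / β) with hTdef
  set D := (1 / (2 * γ)) ^ ((2 * (α - a) + 1) / β) with hD
  have hpow : ∀ᶠ n : ℕ in atTop,
      T n ^ (2 * (α - a) + 1) = D * Real.log n ^ ((2 * (α - a) + 1) / β) := by
    filter_upwards [tendsto_log_natCast.eventually_gt_atTop 0] with n hn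
    rw [hTdef, hD]
    simp only
    rw [← Real.rpow_mul (by positivity), ← Real.mul_rpow (by positivity) hn.le]
    congr 1 <;> ring
  refine rateBound_of_tendsto (t₀ := max t₀ t₁) (tendsto_log_div_rpow hβ hγ)
    (log_div_rpow_neg hγ) ?_ (fun t ht => ?_) (fun t ht => hW t ((le_max_left _ _).trans ht))
    (V := fun t => C₁ * t ^ (2 * (α - a) + 1)) (C₁ := C₁ * D) (C₂ := C₂ * D) ?_ ?_
  · filter_upwards [tendsto_log_natCast.eventually_gt_atTop 0] with n hn
    positivity
  · rw [weight_cancel, ← primitiveWeight_zero]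
    exact hV t ((le_max_right _ _).trans ht)
  · filter_upwards [hpow, eventually_gt_atTop 0] with n h1 h3
    have hn : (n : ℝ) ≠ 0 := by positivity
    rw [mul_inv_cancel_left₀ hn]
    change C₁ * T n ^ _ ≤ _
    rw [h1, mul_assoc]
  · filter_upwards [hpow, exp_neg_mul_log_div_rpow hβ hγ,
      (tendsto_log_div_rpow hβ hγ).eventually_ge_atTop 1] with n h1 h2 h3
    rw [h2]
    change C₂ * (T n ^ _ * _) ≤ _
    have : T n ^ (-(2 * (s + a + (β - 1) / 2))) ≤ T n ^ (2 * (α - a) + 1) :=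
      Real.rpow_le_rpow_of_exponent_le h3 (by linarith)
    calc _ ≤ C₂ * (T n ^ (2 * (α - a) + 1) * (n : ℝ)⁻¹) := by gcongr
      _ = _ := by rw [h1]; ring

end LogBandwidth

/-! ### Polynomial bandwidths: no exponential factors -/

section PolynomialBandwidth

theorem tendsto_natCast_rpow {e : ℝ} (he : 0 < e) :
    Tendsto (fun n : ℕ => (n : ℝ) ^ e) atTop atTop :=
  (tendsto_rpow_atTop he).comp tendsto_natCast_atTop_atTop

theorem natCast_rpow_neg (e : ℝ) : ∀ᶠ n : ℕ in atTop,
    (n : ℝ) ^ (-1 / e) = ((n : ℝ) ^ (1 / e))⁻¹ :=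
  Eventually.of_forall fun n => by
    rw [← Real.rpow_neg (by positivity), neg_div]

/-- The cut-off `T = n^(1/(2A))` reduces the squared bias `T^(-2A)` to `1/n`, while the variance
integral grows only like `log n`. -/
theorem rateBound_poly_critical {s a α A : ℝ} (hA₁ : A = s + a + (0 - 1) / 2) (hA0 : 0 < A)
    (hA : α - a = -1 / 2) :
    RateBound s a 0 0 α 0 0 (fun n => (n : ℝ) ^ (-1 / (2 * A)))
      fun n => (n : ℝ)⁻¹ * Real.log n := by
  obtain ⟨C₁, hC₁, hV⟩ := exists_setLIntegral_Ioc_weight_le_log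
  obtain ⟨C₂, t₀, hC₂, ht₀, hW⟩ := exists_bias_bound (s := s) (a := a)
    (Or.inr ⟨rfl, rfl, hA₁ ▸ hA0⟩)
  rw [← hA₁] at hW
  refine rateBound_of_tendsto (t₀ := max t₀ (Real.exp 1))
    (tendsto_natCast_rpow (e := 1 / (2 * A)) (by positivity))
    (natCast_rpow_neg _) ?_ (fun t ht => ?_) (fun t ht => hW t ((le_max_left _ _).trans ht))
    (V := fun t => C₁ * Real.log t) (C₁ := C₁ * (1 / (2 * A))) (C₂ := C₂) ?_ ?_
  · filter_upwards [tendsto_log_natCast.eventually_gt_atTop 0] with n hn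
    positivity
  · rw [hA]
    simpa [weight] using hV t ((le_max_right _ _).trans ht)
  · filter_upwards [eventually_gt_atTop 0] with n h3
    have hn : (n : ℝ) ≠ 0 := by positivity
    rw [mul_inv_cancel_left₀ hn, Real.log_rpow (by positivity), mul_assoc]
  · filter_upwards [tendsto_log_natCast.eventually_ge_atTop 1, eventually_gt_atTop 0] with n h2 h3
    have e : ((n : ℝ) ^ (1 / (2 * A))) ^ (-(2 * A)) = (n : ℝ)⁻¹ := by
      rw [← Real.rpow_mul (by positivity), ← Real.rpow_neg_one]
      congr 1; field_simp
    rw [e]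
    gcongr
    simpa using h2

/-- The cut-off `T = n^(1/D)` equates `T^(2A₂+1)/n` with `T^(-2A)`. -/
theorem rateBound_poly_supercritical {s a α A : ℝ} (hA₁ : A = s + a + (0 - 1) / 2)
    (hD : 0 < 2 * A + 2 * (α - a) + 1) (hA : α - a > -1 / 2) :
    RateBound s a 0 0 α 0 0 (fun n => (n : ℝ) ^ (-1 / (2 * A + 2 * (α - a) + 1)))
      fun n => (n : ℝ) ^ (-(2 * A) / (2 * A + 2 * (α - a) + 1)) := by
  obtain ⟨C₁, t₁, hC₁, ht₁, hV⟩ := exists_setLIntegral_Ioc_weight_le_primitiveWeight (α - a) 0 0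
    le_rfl le_rfl (by linarith) (tendsto_growthFactor_zero (α - a))
  set D := 2 * A + 2 * (α - a) + 1 with hDdef
  have hT := tendsto_natCast_rpow (e := 1 / D) (by positivity)
  have hexp : 1 + -(2 * A) / D = (2 * (α - a) + 1) / D := by
    have hD0 : D ≠ 0 := hD.ne'
    rw [eq_div_iff hD0, add_mul, div_mul_cancel₀ _ hD0, hDdef]
    ring
  have hVar : ∀ᶠ n : ℕ in atTop, C₁ * ((n : ℝ) ^ (1 / D)) ^ (2 * (α - a) + 1) ≤
      C₁ * (n * (n : ℝ) ^ (-(2 * A) / D)) := by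
    filter_upwards [eventually_gt_atTop 0] with n h3
    have hn : (0 : ℝ) < n := by exact_mod_cast h3
    refine le_of_eq ?_
    rw [← Real.rpow_mul hn.le, ← Real.rpow_one_add' hn.le]
    · rw [hexp, div_mul_eq_mul_div, one_mul]
    · rw [hexp]
      exact (div_pos (by linarith) hD).ne'
  have hV' : ∀ t, t₁ ≤ t → ∫⁻ t in Set.Ioc 0 t,
      ENNReal.ofReal (weight (α - a) (2 * 0) 0 (-2 * 0) 0 t) ≤
        ENNReal.ofReal (C₁ * t ^ (2 * (α - a) + 1)) := fun t ht => by
    rw [← primitiveWeight_zero, mul_zero, mul_zero]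
    exact hV t ht
  -- For `A ≤ 0` the tail integral diverges, but the rate is at least one and the uniform bias bound
  -- takes over.
  rcases le_or_gt A 0 with hA0 | hA0
  · refine rateBound_of_tendsto_of_one_le hT (natCast_rpow_neg _) ?_ hV' hVar
    filter_upwards [eventually_ge_atTop 1] with n hn
    exact Real.one_le_rpow (by exact_mod_cast hn) (div_nonneg (by linarith) hD.le)
  · obtain ⟨C₂, t₀, hC₂, ht₀, hW⟩ := exists_bias_bound (s := s) (a := a)
      (Or.inr ⟨rfl, rfl, hA₁ ▸ hA0⟩)
    rw [← hA₁] at hW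
    refine rateBound_of_tendsto (t₀ := max t₀ t₁) hT (natCast_rpow_neg _)
      (Eventually.of_forall fun n => by positivity) (fun t ht => hV' t ((le_max_right _ _).trans ht))
      (fun t ht => hW t ((le_max_left _ _).trans ht)) hVar (C₂ := C₂) ?_
    refine Eventually.of_forall fun n => le_of_eq ?_
    rw [← Real.rpow_mul (by positivity), mul_zero, zero_mul, Real.exp_zero, mul_one]
    congr 2; ring

end PolynomialBandwidth

/-! ### The bandwidth `h*`: the noise exponential dominates -/

section LogLogBandwidth

/-- The `β`-th power of the cut-off point `1 / hStar`. -/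
noncomputable def cutoffLevel (A₁ A₂ β γ : ℝ) (n : ℕ) : ℝ :=
  1 / (2 * γ) * (Real.log n - (2 * A₁ + 2 * A₂ + 1 - β) / β * Real.log (Real.log n))

/-- Since `log log n` is negligible against `log n`, the correction is eventually at most half of
the main term. -/
theorem cutoffLevel_bounds (A₁ A₂ β : ℝ) {γ : ℝ} (hγ : 0 < γ) : ∀ᶠ n : ℕ in atTop,
    Real.log n / (4 * γ) ≤ cutoffLevel A₁ A₂ β γ n ∧
      cutoffLevel A₁ A₂ β γ n ≤ Real.log n / γ := by
  have h := ((Real.isLittleO_log_id_atTop.comp_tendsto tendsto_log_natCast).const_mul_left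
    ((2 * A₁ + 2 * A₂ + 1 - β) / β)).def (show (0 : ℝ) < 1 / 2 by norm_num)
  filter_upwards [h, tendsto_log_natCast.eventually_gt_atTop 0] with n h1 h2
  simp only [Function.comp_apply, id, Real.norm_eq_abs, abs_of_pos h2] at h1
  obtain ⟨h3, h4⟩ := abs_le.1 h1
  unfold cutoffLevel
  constructor
  · rw [div_mul_eq_mul_div, one_mul, div_le_div_iff₀ (by positivity) (by positivity)]
    nlinarith
  · rw [div_mul_eq_mul_div, one_mul, div_le_div_iff₀ (by positivity) (by positivity)]
    nlinarith

theorem tendsto_cutoffLevel (A₁ A₂ β : ℝ) {γ : ℝ} (hγ : 0 < γ) :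
    Tendsto (cutoffLevel A₁ A₂ β γ) atTop atTop :=
  tendsto_atTop_mono' _ ((cutoffLevel_bounds A₁ A₂ β hγ).mono fun _ h => h.1)
    (tendsto_log_natCast.atTop_div_const (by positivity))

theorem cutoffLevel_rpow_le (A₁ A₂ β e : ℝ) {γ : ℝ} (hγ : 0 < γ) :
    ∃ C : ℝ, 0 < C ∧ ∀ᶠ n : ℕ in atTop,
      cutoffLevel A₁ A₂ β γ n ^ e ≤ C * Real.log n ^ e := by
  -- For `e ≥ 0` the upper bound on the level is used, for `e < 0` the lower one; the sum of both
  -- constants serves either sign.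
  refine ⟨(1 / (4 * γ)) ^ e + (1 / γ) ^ e, by positivity, ?_⟩
  filter_upwards [cutoffLevel_bounds A₁ A₂ β hγ, tendsto_log_natCast.eventually_gt_atTop 0]
    with n ⟨h1, h2⟩ h3
  have h4 : 0 < Real.log n / (4 * γ) := by positivity
  rw [add_mul, ← Real.mul_rpow (by positivity) h3.le, ← Real.mul_rpow (by positivity) h3.le,
    one_div_mul_eq_div, one_div_mul_eq_div]
  rcases le_or_gt 0 e with he | he
  · exact (Real.rpow_le_rpow (h4.le.trans h1) h2 he).trans (le_add_of_nonneg_left (by positivity))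
  · exact (Real.rpow_le_rpow_of_nonpos h4 h1 he.le).trans
      (le_add_of_nonneg_right (by positivity))

theorem hStar_eq_inv (A₁ A₂ β : ℝ) {γ : ℝ} (hγ : 0 < γ) : ∀ᶠ n : ℕ in atTop,
    hStar A₁ A₂ β γ n = (cutoffLevel A₁ A₂ β γ n ^ (1 / β))⁻¹ := by
  filter_upwards [(tendsto_cutoffLevel A₁ A₂ β hγ).eventually_gt_atTop 0] with n hn
  rw [← Real.rpow_neg hn.le, ← neg_div]
  rfl

theorem hStar_rpow_neg (A₁ A₂ β b : ℝ) {γ : ℝ} (hγ : 0 < γ) : ∀ᶠ n : ℕ in atTop,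
    hStar A₁ A₂ β γ n ^ (-b) = (cutoffLevel A₁ A₂ β γ n ^ (1 / β)) ^ b := by
  filter_upwards [hStar_eq_inv A₁ A₂ β hγ, (tendsto_cutoffLevel A₁ A₂ β hγ).eventually_gt_atTop 0]
    with n h1 hn
  rw [h1, Real.inv_rpow (by positivity), Real.rpow_neg (by positivity), inv_inv]

/-- The `log log n` correction of the bandwidth becomes a power of `log n`. The variance uses `κ =
1`, and the explicit rate for `b = β` uses `κ = -d/γ`. -/
theorem exp_mul_cutoffLevel (A₁ A₂ β κ : ℝ) {γ : ℝ} (hγ : 0 < γ) : ∀ᶠ n : ℕ in atTop,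
    Real.exp (κ * (2 * γ * cutoffLevel A₁ A₂ β γ n)) =
      (n : ℝ) ^ κ * Real.log n ^ (-(κ * ((2 * A₁ + 2 * A₂ + 1 - β) / β))) := by
  filter_upwards [tendsto_log_natCast.eventually_gt_atTop 0, eventually_gt_atTop 0] with n h1 h2
  have hn : (0 : ℝ) < n := by exact_mod_cast h2
  rw [Real.rpow_def_of_pos hn, Real.rpow_def_of_pos h1, ← Real.exp_add]
  congr 1
  unfold cutoffLevel
  field_simp
  ring

/-- The common part of the regimes with a logarithmically corrected bandwidth. -/
theorem rateBound_hStar {s a b d α β γ A : ℝ} (hβ : 0 < β) (hγ : 0 < γ) (hb : 0 ≤ b)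
    (hA : A = s + a + (b - 1) / 2) (hcase : (b < β) ∨ (b = β ∧ d < γ))
    (hbias : (0 < b ∧ 0 < d) ∨ (b = 0 ∧ d = 0)) :
    RateBound s a b d α β γ (hStar A (α - a) β γ) fun n =>
      Real.log n ^ (-(2 * A) / β) * Real.exp (-2 * d * hStar A (α - a) β γ n ^ (-b)) := by
  have hvar : ∃ C t₀ : ℝ, 0 < C ∧ 1 ≤ t₀ ∧ ∀ T, t₀ ≤ T →
      ∫⁻ t in Set.Ioc 0 T, ENNReal.ofReal (weight (α - a) (2 * γ) β (-2 * d) b t) ≤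
        ENNReal.ofReal (C * primitiveWeight (α - a) (2 * γ) β (-2 * d) b T) := by
    -- For `b = β` the two exponentials merge into one with coefficient `2γ - 2d > 0`.
    rcases hcase with h | ⟨rfl, h⟩
    · exact exists_setLIntegral_Ioc_weight_le_primitiveWeight _ _ _ hβ.le hb (by positivity)
        (tendsto_growthFactor (α - a) (2 * γ) (-2 * d) hβ h)
    · obtain ⟨C, t₀, hC, ht₀, hV⟩ := exists_setLIntegral_Ioc_weight_le_primitiveWeight (α - a)
        (2 * γ + -2 * d) 0 hβ.le le_rfl (by nlinarith)
        (tendsto_growthFactor (α - a) (2 * γ + -2 * d) 0 hβ hβ)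
      refine ⟨C, t₀, hC, ht₀, fun T hT => ?_⟩
      rw [weight_same_exponent]
      refine (hV T hT).trans (le_of_eq ?_)
      simp only [primitiveWeight]
      ring_nf
  obtain ⟨C₁, t₁, hC₁, ht₁, hV⟩ := hvar
  set X := cutoffLevel A (α - a) β γ with hX
  set T := fun n : ℕ => X n ^ (1 / β) with hTdef
  have hXtop : Tendsto X atTop atTop := tendsto_cutoffLevel A (α - a) β hγ
  have hT : Tendsto T atTop atTop := (tendsto_rpow_atTop (by positivity)).comp hXtop
  have hTh : ∀ᶠ n in atTop, hStar A (α - a) β γ n = (T n)⁻¹ := hStar_eq_inv A (α - a) β hγ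
  have hTb : ∀ᶠ n in atTop, hStar A (α - a) β γ n ^ (-b) = T n ^ b :=
    hStar_rpow_neg A (α - a) β b hγ
  obtain ⟨D₁, hD₁, hX₁⟩ := cutoffLevel_rpow_le A (α - a) β ((2 * (α - a) + 1 - β) / β) hγ
  obtain ⟨D₂, hD₂, hX₂⟩ := cutoffLevel_rpow_le A (α - a) β (-(2 * A) / β) hγ
  have hVar : ∀ᶠ n : ℕ in atTop, C₁ * primitiveWeight (α - a) (2 * γ) β (-2 * d) b (T n) ≤
      C₁ * D₁ * (n * (Real.log n ^ (-(2 * A) / β) *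
        Real.exp (-2 * d * hStar A (α - a) β γ n ^ (-b)))) := by
    filter_upwards [hTb, hX₁, exp_mul_cutoffLevel A (α - a) β 1 hγ,
      hXtop.eventually_gt_atTop 0, tendsto_log_natCast.eventually_gt_atTop 0] with n h1 h2 h3 h4 h5
    have e1 : T n ^ (2 * (α - a) + 1 - β) = X n ^ ((2 * (α - a) + 1 - β) / β) := by
      rw [hTdef]
      simp only
      rw [← Real.rpow_mul h4.le]; congr 1; ring
    have e2 : T n ^ β = X n := by
      rw [hTdef]
      simp only
      rw [← Real.rpow_mul h4.le, one_div_mul_cancel hβ.ne', Real.rpow_one]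
    -- The correction in `h*` is designed for this cancellation: the power of `log n` in the
    -- variance becomes `-2A/β`, the one in the squared bias.
    have e3 : Real.log n ^ ((2 * (α - a) + 1 - β) / β) *
        Real.log n ^ (-(1 * ((2 * A + 2 * (α - a) + 1 - β) / β))) =
          Real.log n ^ (-(2 * A) / β) := by
      rw [← Real.rpow_add h5]; congr 1; ring
    rw [one_mul, Real.rpow_one] at h3
    rw [primitiveWeight, e1, e2, h1, Real.exp_add, h3, ← e3]
    calc _ ≤ C₁ * ((D₁ * Real.log n ^ ((2 * (α - a) + 1 - β) / β)) *
          (n * Real.log n ^ (-(1 * ((2 * A + 2 * (α - a) + 1 - β) / β))) *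
            Real.exp (-2 * d * T n ^ b))) := by gcongr
      _ = _ := by ring
  -- Here the Cauchy-Schwarz tail is infinite, but the rate is eventually at least one.
  by_cases hneg : b = 0 ∧ d = 0 ∧ A ≤ 0
  · obtain ⟨rfl, rfl, hA0⟩ := hneg
    refine rateBound_of_tendsto_of_one_le hT hTh ?_ hV hVar
    filter_upwards [tendsto_log_natCast.eventually_ge_atTop 1] with n hn
    rw [mul_zero, zero_mul, Real.exp_zero, mul_one]
    exact Real.one_le_rpow hn (div_nonneg (by linarith) hβ.le)
  · have hb' : (0 < b ∧ 0 < d) ∨ (b = 0 ∧ d = 0 ∧ 0 < s + a + (b - 1) / 2) := by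
      rcases hbias with h | ⟨h1, h2⟩
      · exact Or.inl h
      · refine Or.inr ⟨h1, h2, ?_⟩
        by_contra hcon
        exact hneg ⟨h1, h2, by rw [hA]; linarith⟩
    obtain ⟨C₂, t₀, hC₂, ht₀, hW⟩ := exists_bias_bound hb'
    rw [← hA] at hW
    refine rateBound_of_tendsto (t₀ := max t₀ t₁) hT hTh ?_
      (fun t ht => hV t ((le_max_right _ _).trans ht))
      (fun t ht => hW t ((le_max_left _ _).trans ht)) hVar (C₂ := C₂ * D₂) ?_
    · filter_upwards [tendsto_log_natCast.eventually_ge_atTop 0] with n hn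
      positivity
    · filter_upwards [hTb, hX₂, hXtop.eventually_gt_atTop 0] with n h1 h2 h3
      have e1 : T n ^ (-(2 * A)) = X n ^ (-(2 * A) / β) := by
        rw [hTdef]
        simp only
        rw [← Real.rpow_mul h3.le]; congr 1; ring
      rw [e1, h1]
      calc _ ≤ C₂ * ((D₂ * Real.log n ^ (-(2 * A) / β)) * Real.exp (-2 * d * T n ^ b)) := by
            gcongr
        _ = _ := by ring

theorem hStar_rate_eq (A₁ A₂ d : ℝ) {β γ : ℝ} (hβ : 0 < β) (hγ : 0 < γ) : ∀ᶠ n : ℕ in atTop,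
    Real.log n ^ (-(2 * A₁) / β) * Real.exp (-2 * d * hStar A₁ A₂ β γ n ^ (-β)) =
      Real.log n ^ (-V₁ A₁ A₂ d β γ) * (n : ℝ) ^ (-d / γ) := by
  filter_upwards [hStar_rpow_neg A₁ A₂ β β hγ, exp_mul_cutoffLevel A₁ A₂ β (-d / γ) hγ,
    (tendsto_cutoffLevel A₁ A₂ β hγ).eventually_gt_atTop 0,
    tendsto_log_natCast.eventually_gt_atTop 0] with n h1 h2 h3 h4
  have e : -d / γ * (2 * γ * cutoffLevel A₁ A₂ β γ n) = -2 * d * cutoffLevel A₁ A₂ β γ n := by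
    field_simp
  rw [e] at h2
  rw [h1, ← Real.rpow_mul h3.le, one_div_mul_cancel hβ.ne', Real.rpow_one, h2, mul_left_comm,
    ← Real.rpow_add h4, mul_comm]
  congr 2
  unfold V₁
  field_simp
  ring

end LogLogBandwidth

/-! ### Assembling the ten regimes -/

theorem RateBound.congr {s a b d α β γ : ℝ} {h Δ Δ' : ℕ → ℝ} (hR : RateBound s a b d α β γ h Δ)
    (hΔ : ∀ᶠ n in atTop, Δ n = Δ' n) : RateBound s a b d α β γ h Δ' := by
  obtain ⟨C, hC, hev⟩ := hR
  refine ⟨C, hC, ?_⟩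
  filter_upwards [hev, hΔ] with n h1 h2
  rwa [← h2]

theorem RateTable.rateBound {s a b d α β γ : ℝ} (hs : 0 ≤ s) (hb : 0 ≤ b) (hd : 0 ≤ d)
    (hα : 0 ≤ α) (hβ : 0 ≤ β) (hγ₀ : γ = 0 → 0 < α ∧ β = 0) (hd₀ : d = 0 → b = 0)
    {h Δ : ℕ → ℝ} (hT : RateTable (s + a + (b - 1) / 2) (α - a) b d β γ h Δ) :
    RateBound s a b d α β γ h Δ := by
  cases hT with
  | case1 hb' =>
    -- As `b > β ≥ 0` and `d = 0` would force `b = 0`, necessarily `d > 0`.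
    refine rateBound_of_lt s a b d α β γ hβ hb' (hd.lt_of_ne fun h0 => ?_)
    have := hd₀ h0.symm
    linarith
  | case2 hb' hβ' hd' hγ' =>
    subst hb'
    exact rateBound_of_eq_of_lt s a d α b γ hβ' hd'
  | case3 hb' hd' hA =>
    subst hb' hd'
    exact rateBound_of_eq_of_eq s a α b d hA
  | case4 hb' hβ' hd' hγ' hA =>
    subst hb' hd'
    exact rateBound_log_critical hs hα hβ' hγ' hA
  | case5 hb' hβ' hd' hγ' hA =>
    subst hb' hd'
    exact rateBound_log_supercritical hs hα hβ' hγ' hA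
  | case6 hb' hβ' hd' hγ' hA =>
    subst hb' hβ' hd' hγ'
    -- With `a = α + 1/2` one has `A₁ = s + α`, positive because `γ = 0` entails `α > 0`.
    have := (hγ₀ rfl).1
    exact rateBound_poly_critical rfl (by linarith) hA
  | case7 hb' hβ' hd' hγ' hA =>
    subst hb' hβ' hd' hγ'
    -- The denominator `2A₁ + 2A₂ + 1` equals `2s + 2α`, again positive because `α > 0`.
    have := (hγ₀ rfl).1
    exact rateBound_poly_supercritical rfl (by linarith) hA
  | case8 hb' hβ' hd' hd₀' =>
    subst hb'
    have hγ : 0 < γ := by linarith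
    exact (rateBound_hStar hβ' hγ hb rfl (Or.inr ⟨rfl, hd'⟩) (Or.inl ⟨hβ', hd₀'⟩)).congr
      (hStar_rate_eq _ _ _ hβ' hγ)
  | case9 hβ' hb' hd' hγ' =>
    exact rateBound_hStar (by linarith) hγ' hb rfl (Or.inl hβ') (Or.inl ⟨hb', hd'⟩)
  | case10 hb' hd' hβ' hγ' =>
    subst hb' hd'
    refine (rateBound_hStar hβ' hγ' le_rfl rfl (Or.inl hβ') (Or.inr ⟨rfl, rfl⟩)).congr
      (Eventually.of_forall fun n => ?_)
    simp

end Deconv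

theorem theorem1
    (s B a b d α β γ Cg Cφ : ℝ)
    (hs : 0 ≤ s) (hB : 0 < B)
    (ha : 0 ≤ a) (hb : 0 ≤ b) (hd : 0 ≤ d)
    (hα : 0 ≤ α) (hβ : 0 ≤ β) (hγ : 0 ≤ γ)
    (hCg : 0 < Cg) (hCφ : 0 ≤ Cφ)
    (hγ₀ : γ = 0 → 0 < α ∧ β = 0)
    (hd₀ : d = 0 → b = 0)
    (g : ℝ → ℝ) (hg : Deconv.IsPdf g) (hg_bdd : BddAbove (Set.range g))
    (hg_low : ∀ ω : ℝ,
      Cg * (ω ^ 2 + 1) ^ (-α / 2) * Real.exp (-γ * |ω| ^ β) ≤ ‖Deconv.ft g ω‖)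
    (φs : ℝ → ℂ) (hφ_meas : Measurable φs)
    (hφ_up : ∀ ω : ℝ,
      ‖φs ω‖ ≤ Cφ * (ω ^ 2 + 1) ^ (-a / 2) * Real.exp (-d * |ω| ^ b))
    (Φ : (ℝ → ℝ) → ℂ) (hΦ : Deconv.IsRepresentedOn (Deconv.sobolevBall s B) Φ φs)
    (h Δ : ℕ → ℝ)
    (hT : Deconv.RateTable (s + a + (b - 1) / 2) (α - a) b d β γ h Δ) :
    ∃ C : ℝ, 0 < C ∧ ∀ᶠ n : ℕ in Filter.atTop,
      Deconv.worstRisk (Deconv.sobolevBall s B) g Φ φs n (h n) ≤ ENNReal.ofReal (C * Δ n) := by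
  obtain ⟨K, hK, hrisk⟩ := Deconv.exists_worstRisk_le hB hCg hCφ hg hg_bdd hg_low hφ_meas hφ_up hΦ
  obtain ⟨C, hC, hev⟩ := Deconv.RateTable.rateBound hs hb hd hα hβ hγ₀ hd₀ hT
  -- Variance and bias each contribute `C Δ n`; the added 1 gives positivity when `C = 0`.
  refine ⟨K * (2 * C) + 1, by positivity, ?_⟩
  filter_upwards [hev, Filter.eventually_gt_atTop 0] with n ⟨hΔ, hV, hW⟩ hn
  have hn' : (n : ℝ) ≠ 0 := by positivity
  refine (hrisk n (h n) (C * (n * Δ n)) (C * Δ n) hn (by positivity) (by positivity) hV hW).trans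
    (ENNReal.ofReal_le_ofReal ?_)
  have e : (n : ℝ)⁻¹ * (C * (n * Δ n)) = C * Δ n := by field_simp
  rw [e]
  nlinarith
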